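/- Let $\alpha,\beta>-1$ and $N>0$. Write $(a)_n=a(a+1)\cdots(a+n-1)$, let $P_n^{\alpha,\beta}$ be the standard Jacobi polynomials, and let $$Q_n(x)=\frac{n!}{(\alpha+1)_n}\cdot\frac{(\alpha+\beta+2)_{n-1}}{n!}\,A_n\Big[-N(1+x)\frac{d}{dx}+B_n\Big]P_n^{\alpha,\beta}(x),\qquad A_n=\frac{(\alpha+1)_n}{(\beta+1)_n},$$ $$B_n=\frac{(\beta+1)_n\,n!}{(\alpha+1)_n(\alpha+\beta+2)_{n-1}}+\frac{n(n+\alpha+\beta+1)N}{\alpha+1}\qquad(n\ge 0;\ Q_0=1)$$ be Koornwinder's Jacobi type polynomials, normalized by $Q_n(1)=1$; they are orthogonal for the probability measure $$d\psi(x)=\frac{1}{N+1}\Big(\frac{(1-x)^\alpha(1+x)^\beta}{2^{\alpha+\beta+1}\mathcal B(\alpha+1,\beta+1)}\mathbf 1_{(-1,1)}(x)\,dx+N\delta_1(x)\Big),$$ where $\mathcal B$ is the beta function. Let $p_i,r_i,q_i$ be the coefficients of $Q_{i+1},Q_i,Q_{i-1}$ in the expansion of $xQ_i$ in this orthogonal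 system, with $q_0=0$; then $$xQ_i(x)=p_iQ_{i+1}(x)+r_iQ_i(x)+q_iQ_{i-1}(x)\qquad(i\ge0,\ Q_{-1}=0).$$ Let $H$ be the tridiagonal matrix on $\{0,1,2,\dots\}$ with rows $(q_i,r_i,p_i)$, let $P_\lambda=\frac1{\lambda+1}(H+\lambda I)$, and let $\pi_n=\frac{p_0\cdots p_{n-1}}{q_1\cdots q_n}$ ($\pi_0=1$). **Lemma.** Assume that $p_n>0$ for all $n\ge0$, $q_n>0$ for all $n\ge1$, and $-\inf_i r_i\le\lambda<\infty$. Then $\sum_n\pi_n<\infty$, and $\nu=\pi/\sum_k\pi_k$ is the unique stationary probability distribution of the Markov chain $P_\lambda$. Let $\mu_t=\delta_jP_\lambda^t$ be the law at time $t$ of the chain started at $j$. Then there is a constant $C_{\alpha,\beta,\lambda}$, depending only on $\alpha,\beta,\lambda$ (not on $N$, $j$ or $t$), such that for all integers $j,t\ge0$ $$\|\nu-\mu_t\|_{TV}\le\frac{C_{\alpha,\beta,\lambda}\,\|Q_j\|_\infty}{(t+1)^{1+\alpha}}\sum_{n=0}^{t+j}\pi_n\|Q_n\|_\infty+\frac12\sum_{n=j+t+1}^{\infty}\pi_n,$$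 where $\|\mu-\nu\|_{TV}=\frac12\sum_n|\mu(n)-\nu(n)|$ and $\|Q\|_\infty=\max_{x\in[-1,1]}|Q(x)|$. -/

import Mathlib

open MeasureTheory Polynomial

namespace KoornwinderJacobi

noncomputable section

/-- The Pochhammer symbol (rising factorial) `(a)_n = a (a + 1) ⋯ (a + n - 1)`, with `(a)_0 = 1`. -/
def poch (a : ℝ) (n : ℕ) : ℝ := ∏ i ∈ Finset.range n, (a + i)

/-- The standard Jacobi polynomial
`P_n^{α,β}(x) = (α+1)_n / n! * ∑_k (-n)_k (n+α+β+1)_k / ((α+1)_k k!) * ((1-x)/2)^k`. -/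
def jacobi (α β : ℝ) (n : ℕ) : ℝ[X] :=
  C (poch (α + 1) n / (n.factorial : ℝ)) *
    ∑ k ∈ Finset.range (n + 1),
      C (poch (-(n : ℝ)) k * poch ((n : ℝ) + α + β + 1) k /
          (poch (α + 1) k * (k.factorial : ℝ))) * (C (1 / 2) * (1 - X)) ^ k

/-- `A_n = (α+1)_n / (β+1)_n`. -/
def coeffA (α β : ℝ) (n : ℕ) : ℝ := poch (α + 1) n / poch (β + 1) n

/-- `B_n = (β+1)_n n! / ((α+1)_n (α+β+2)_{n-1}) + n (n+α+β+1) N / (α+1)`.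
For `n = 0` the symbol `(α+β+2)_{n-1}` is read as `1`; it occurs here and, inverted, in the prefactor
of `koornwinder`, and cancels there, so that its value is irrelevant. -/
def coeffB (α β N : ℝ) (n : ℕ) : ℝ :=
  poch (β + 1) n * (n.factorial : ℝ) / (poch (α + 1) n * poch (α + β + 2) (n - 1)) +
    (n : ℝ) * ((n : ℝ) + α + β + 1) * N / (α + 1)

/-- Koornwinder's Jacobi type polynomial
`P_n^{α,β,N} = (α+β+2)_{n-1} / n! * A_n * [-N (1+x) d/dx + B_n] P_n^{α,β}`. -/
def koornwinder (α β N : ℝ) (n : ℕ) : ℝ[X] :=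
  C (poch (α + β + 2) (n - 1) / (n.factorial : ℝ) * coeffA α β n) *
    (-(C N) * (1 + X) * derivative (jacobi α β n) + C (coeffB α β N n) * jacobi α β n)

/-- The normalization `Q_n = n! P_n^{α,β,N} / (α+1)_n`, for which `Q_n(1) = 1`. -/
def Q (α β N : ℝ) (n : ℕ) : ℝ[X] :=
  C ((n.factorial : ℝ) / poch (α + 1) n) * koornwinder α β N n

/-- The orthogonality probability measure
`dψ(x) = (c (1-x)^α (1+x)^β dx + N δ_1) / (N + 1)`, where the Jacobi weight on `(-1, 1)` is normalized
to total mass one: `c = 1 / (2^{α+β+1} B(α+1, β+1))`. -/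
def psi (α β N : ℝ) : Measure ℝ :=
  ENNReal.ofReal (1 / (N + 1)) •
    ((volume.restrict (Set.Ioo (-1 : ℝ) 1)).withDensity (fun x => ENNReal.ofReal
        (1 / ((2 : ℝ) ^ (α + β + 1) * ProbabilityTheory.beta (α + 1) (β + 1)) *
          ((1 - x) ^ α * (1 + x) ^ β))) +
      ENNReal.ofReal N • Measure.dirac (1 : ℝ))

/-- The coefficient of `Q_n` in the expansion of `x Q_i(x)` in the orthogonal system `(Q_n)`. -/
def expansionCoeff (α β N : ℝ) (i n : ℕ) : ℝ :=
  (∫ x, x * (Q α β N i).eval x * (Q α β N n).eval x ∂(psi α β N)) /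
    (∫ x, ((Q α β N n).eval x) ^ 2 ∂(psi α β N))

/-- `p_i`, the coefficient of `Q_{i+1}` in `x Q_i`. -/
def p (α β N : ℝ) (i : ℕ) : ℝ := expansionCoeff α β N i (i + 1)

/-- `r_i`, the coefficient of `Q_i` in `x Q_i`. -/
def r (α β N : ℝ) (i : ℕ) : ℝ := expansionCoeff α β N i i

/-- `q_i`, the coefficient of `Q_{i-1}` in `x Q_i`; since `Q_{-1} = 0` there is no `q_0`, and
it is set to `0`. -/
def q (α β N : ℝ) : ℕ → ℝ
  | 0 => 0
  | i + 1 => expansionCoeff α β N (i + 1) i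

/-- The tridiagonal operator `H` of the three term recursion. -/
def H (α β N : ℝ) (i k : ℕ) : ℝ :=
  if k = i + 1 then p α β N i
  else if k = i then r α β N i
  else if k + 1 = i then q α β N i
  else 0

/-- `P_lam = (H + lam I) / (lam + 1)`. -/
def transition (α β N lam : ℝ) (i k : ℕ) : ℝ :=
  1 / (lam + 1) * (H α β N i k + lam * (if i = k then 1 else 0))

/-- The reversibility function `π_n = (p_0 ⋯ p_{n-1}) / (q_1 ⋯ q_n)`. -/
def revMeasure (α β N : ℝ) (n : ℕ) : ℝ :=
  (∏ i ∈ Finset.range n, p α β N i) / (∏ i ∈ Finset.range n, q α β N (i + 1))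

/-- `ν = π / ρ`, where `ρ = ∑ π_k`. -/
def stationary (α β N : ℝ) (n : ℕ) : ℝ :=
  revMeasure α β N n / ∑' k, revMeasure α β N k

/-- The law `μ_t = μ_0 P_lam^t` of the walk started at `j`. (Each of the series has at most three
nonzero terms, `P_lam` being tridiagonal.) -/
def law (α β N lam : ℝ) (j : ℕ) : ℕ → ℕ → ℝ
  | 0, n => if n = j then 1 else 0
  | t + 1, n => ∑' i, law α β N lam j t i * transition α β N lam i n

/-- `ν` is a stationary probability distribution for the transition matrix `P` on `ℕ`. -/
def IsStationaryDistribution (P : ℕ → ℕ → ℝ) (ν : ℕ → ℝ) : Prop :=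
  (∀ n, 0 ≤ ν n) ∧ HasSum ν 1 ∧ ∀ k, HasSum (fun i => ν i * P i k) (ν k)

/-- Total variation distance of two probability distributions on `ℕ`. -/
def tvDist (μ ν : ℕ → ℝ) : ℝ := 1 / 2 * ∑' n, |μ n - ν n|

/-- The sup norm of a polynomial on `[-1, 1]`. -/
def supNorm (f : ℝ[X]) : ℝ := ⨆ x : Set.Icc (-1 : ℝ) 1, |f.eval (x : ℝ)|

end

end KoornwinderJacobi

/-!
Write `y = (1 - x) / 2`, and let `E` be the expectation for the normalized Jacobi weight, so that
integration against `psi` is `(E f + N f(1)) / (N + 1)`.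

*Orthogonality.* The moments of `E` in `y` and `1 - y` are quotients of Pochhammer symbols, so `E`
of a Jacobi polynomial, or of its derivative, times a power of `1 + x` is a Chu–Vandermonde sum. In
this way `E[P_n (1 + x)^m]` vanishes for `m < n`, while `E[(1 + x) P_n' ((1 + x) / 2)^m]` is a
constant independent of `m < n` (`integral_derivative_jacobi_mul_pow`). By the choice of `B_n` this
constant is the value at `1` of `[-N (1 + x) d/dx + B_n] P_n`, and the atom at `1` makes `Q_n`
orthogonal to all lower degrees (`integral_Q_mul_eval_eq_zero`). The three term recursion
(`X_mul_Q`) and `π_n = 1 / ‖Q_n‖²` (`revMeasure_eq`) follow.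

*Stationarity.* `∑ π_n` is the reciprocal `(N + 1) / N` of the atom of `psi` at `1`
(`tsum_revMeasure`): it is the value at `1` of the kernel polynomials, whose extremal property
gives both bounds. By detailed balance the density of a stationary measure with respect to `π` is
harmonic, hence constant, since `p_n + r_n + q_n = 1` (`isStationaryDistribution_iff`).

*Convergence.* By the Karlin–McGregor formula (`law_eq`),
`μ_t(n) = π_n ∫ ((x + lam) / (lam + 1))^t Q_j Q_n dψ`. The atom at `1`, where the integrand is `1`,
contributes exactly `ν(n)`, and the rest is at most
`π_n ‖Q_j‖ ‖Q_n‖ E |(x + lam) / (lam + 1)|^t`, in which no `N` is left. For `n > t + j` the law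
vanishes by degree. The expectation decays like `t^{-1-α}` by a Laplace type estimate at `x = 1`,
as long as the endpoint `x = -1` contributes no more, that is, if `lam > 0`, or if `lam = 0` and
`α ≤ β`.

*The range of `lam`.* These are the only cases compatible with `r_i ≥ -lam` (`lam_pos_or`). The
trace `r_0 + ⋯ + r_{n-1}` can be read off from the two leading coefficients of `Q_n`, and it is
bounded above by a sequence which tends to `(β - α) / 2` (`sum_r_le`). A negative `lam` would make
it grow linearly, and `lam = 0` makes it nonnegative.
-/

namespace KoornwinderJacobi

noncomputable section

/-! ### Pochhammer symbols and the Chu–Vandermonde sum -/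

@[simp] theorem poch_zero (a : ℝ) : poch a 0 = 1 := by simp [poch]

@[simp] theorem poch_one (a : ℝ) : poch a 1 = a := by simp [poch]

theorem poch_succ (a : ℝ) (n : ℕ) : poch a (n + 1) = poch a n * (a + n) :=
  Finset.prod_range_succ _ _

theorem poch_succ_left (a : ℝ) (n : ℕ) : poch a (n + 1) = a * poch (a + 1) n := by
  rw [poch, Finset.prod_range_succ', mul_comm, poch]
  congr 1
  · simp
  · refine Finset.prod_congr rfl fun i _ => ?_
    push_cast
    ring

theorem poch_add (a : ℝ) (m n : ℕ) : poch a (m + n) = poch a m * poch (a + m) n := by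
  rw [poch, Finset.prod_range_add, poch, poch]
  congr 1
  refine Finset.prod_congr rfl fun i _ => ?_
  push_cast
  ring

theorem poch_pos {a : ℝ} (ha : 0 < a) (n : ℕ) : 0 < poch a n :=
  Finset.prod_pos fun i _ => by positivity

theorem poch_ne_zero {a : ℝ} (ha : 0 < a) (n : ℕ) : poch a n ≠ 0 := (poch_pos ha n).ne'

theorem poch_one_eq_factorial (n : ℕ) : poch 1 n = n.factorial := by
  induction n with
  | zero => simp
  | succ n ih =>
    rw [poch_succ, ih, Nat.factorial_succ]
    push_cast
    ring

theorem poch_neg_eq_choose (n k : ℕ) :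
    poch (-(n : ℝ)) k = (-1) ^ k * (n.choose k * k.factorial) := by
  induction k with
  | zero => simp
  | succ k ih =>
    have h : ((n.choose (k + 1) : ℝ)) * (k + 1) = n.choose k * (n - k) := by
      rcases le_total k n with hk | hk
      · have := Nat.choose_succ_right_eq n k
        rw [← Nat.cast_sub hk]
        exact_mod_cast this
      · rcases hk.eq_or_lt with rfl | hk
        · simp
        · rw [Nat.choose_eq_zero_of_lt hk, Nat.choose_eq_zero_of_lt (by omega)]
          simp
    rw [poch_succ, ih, Nat.factorial_succ]
    push_cast
    linear_combination (-(-1) ^ (k + 1) * (k.factorial : ℝ)) * h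

/-- A rising factorial starting at a nonpositive integer vanishes once it passes through `0`. -/
theorem poch_neg_eq_zero {n k : ℕ} (h : n < k) : poch (-(n : ℝ)) k = 0 := by
  rw [poch_neg_eq_choose, Nat.choose_eq_zero_of_lt h]
  simp

/-- The Chu–Vandermonde identity `₂F₁(-n, b; c; 1) = (c-b)_n / (c)_n`. It follows from the
contiguity relation `F_{n+1}(b, c) = F_n(b, c) - (b / c) F_n(b+1, c+1)`. -/
theorem chu_vandermonde (n : ℕ) (b c : ℝ) (hc : 0 < c) :
    ∑ k ∈ Finset.range (n + 1), (-1) ^ k * (n.choose k : ℝ) * (poch b k / poch c k) =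
      poch (c - b) n / poch c n := by
  induction n generalizing b c with
  | zero => simp
  | succ n ih =>
    have hsplit : ∑ k ∈ Finset.range (n + 1 + 1),
          (-1) ^ k * ((n + 1).choose k : ℝ) * (poch b k / poch c k) =
        ∑ k ∈ Finset.range (n + 1), (-1) ^ k * (n.choose k : ℝ) * (poch b k / poch c k) -
        b / c * ∑ k ∈ Finset.range (n + 1),
          (-1) ^ k * (n.choose k : ℝ) * (poch (b + 1) k / poch (c + 1) k) := by
      have hext : ∑ k ∈ Finset.range (n + 1), (-1) ^ k * (n.choose k : ℝ) *
            (poch b k / poch c k) =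
          ∑ k ∈ Finset.range (n + 1), (-1) ^ (k + 1) * (n.choose (k + 1) : ℝ) *
            (poch b (k + 1) / poch c (k + 1)) + 1 := by
        have h1 := Finset.sum_range_succ (fun k => (-1) ^ k * (n.choose k : ℝ) *
            (poch b k / poch c k)) (n + 1)
        rw [Nat.choose_succ_self, Nat.cast_zero, mul_zero, zero_mul, add_zero,
          Finset.sum_range_succ'] at h1
        rw [← h1]
        simp
      rw [Finset.sum_range_succ', hext, Finset.mul_sum, add_sub_right_comm,
        ← Finset.sum_sub_distrib]
      congr 1
      · refine Finset.sum_congr rfl fun k _ => ?_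
        rw [Nat.choose_succ_succ, poch_succ_left b, poch_succ_left c]
        have := poch_ne_zero (show 0 < c + 1 by linarith) k
        field_simp
        push_cast
        ring
      · simp
    rw [hsplit, ih b c hc, ih (b + 1) (c + 1) (by linarith), poch_succ c,
      poch_succ (c - b), show c + 1 - (b + 1) = c - b by ring]
    have h1 := poch_ne_zero hc n
    have h2 := poch_ne_zero (show 0 < c + 1 by linarith) n
    have h3 : poch c n * (c + n) = c * poch (c + 1) n := by rw [← poch_succ, poch_succ_left]
    have h4 : 0 < c + n := by positivity
    rw [h3, show poch (c - b) n / poch c n = poch (c - b) n * (c + n) / (c * poch (c + 1) n) by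
      rw [← h3]; field_simp]
    field_simp
    ring

/-! ### The Jacobi probability measure and its mixed moments -/

/-- The absolutely continuous part of `psi`, as a probability measure: the Jacobi weight on
`(-1, 1)`, normalized to total mass one. -/
def jacobiMeasure (α β : ℝ) : Measure ℝ :=
  (volume.restrict (Set.Ioo (-1 : ℝ) 1)).withDensity (fun x => ENNReal.ofReal
    (1 / ((2 : ℝ) ^ (α + β + 1) * ProbabilityTheory.beta (α + 1) (β + 1)) *
      ((1 - x) ^ α * (1 + x) ^ β)))

theorem integrableOn_beta {a b : ℝ} (ha : -1 < a) (hb : -1 < b) :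
    IntegrableOn (fun y : ℝ => y ^ a * (1 - y) ^ b) (Set.Ioo 0 1) := by
  have h := Complex.betaIntegral_convergent (u := ((a + 1 : ℝ) : ℂ)) (v := ((b + 1 : ℝ) : ℂ))
    (by rw [Complex.ofReal_re]; linarith) (by rw [Complex.ofReal_re]; linarith)
  rw [intervalIntegrable_iff_integrableOn_Ioo_of_le zero_le_one] at h
  refine IntegrableOn.congr_fun (Integrable.re h) (fun y hy => ?_) measurableSet_Ioo
  have h1 : ((a + 1 : ℝ) : ℂ) - 1 = (a : ℂ) := by push_cast; ring
  have h2 : ((b + 1 : ℝ) : ℂ) - 1 = (b : ℂ) := by push_cast; ring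
  have h3 : (1 : ℂ) - (y : ℂ) = ((1 - y : ℝ) : ℂ) := by push_cast; ring
  simp only [h1, h2, h3]
  rw [← Complex.ofReal_cpow hy.1.le, ← Complex.ofReal_cpow (by linarith [hy.2]),
    ← Complex.ofReal_mul]
  exact Complex.ofReal_re _

theorem integral_beta {a b : ℝ} (ha : -1 < a) (hb : -1 < b) :
    ∫ y in Set.Ioo (0 : ℝ) 1, y ^ a * (1 - y) ^ b = ProbabilityTheory.beta (a + 1) (b + 1) := by
  have h := Complex.betaIntegral_convergent (u := ((a + 1 : ℝ) : ℂ)) (v := ((b + 1 : ℝ) : ℂ))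
    (by rw [Complex.ofReal_re]; linarith) (by rw [Complex.ofReal_re]; linarith)
  rw [intervalIntegrable_iff_integrableOn_Ioo_of_le zero_le_one] at h
  rw [ProbabilityTheory.beta_eq_betaIntegralReal _ _ (by linarith) (by linarith),
    Complex.betaIntegral, intervalIntegral.integral_of_le zero_le_one,
    integral_Ioc_eq_integral_Ioo]
  refine Eq.trans ?_ (integral_re h)
  refine setIntegral_congr_fun measurableSet_Ioo (fun y hy => ?_)
  have h1 : ((a + 1 : ℝ) : ℂ) - 1 = (a : ℂ) := by push_cast; ring
  have h2 : ((b + 1 : ℝ) : ℂ) - 1 = (b : ℂ) := by push_cast; ring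
  have h3 : (1 : ℂ) - (y : ℂ) = ((1 - y : ℝ) : ℂ) := by push_cast; ring
  simp only [h1, h2, h3]
  rw [← Complex.ofReal_cpow hy.1.le, ← Complex.ofReal_cpow (by linarith [hy.2]),
    ← Complex.ofReal_mul]
  exact (Complex.ofReal_re _).symm

theorem image_one_sub_two_mul_Ioo :
    (fun y : ℝ => 1 - 2 * y) '' Set.Ioo (0 : ℝ) 1 = Set.Ioo (-1) 1 := by
  ext x
  constructor
  · rintro ⟨y, hy, rfl⟩
    constructor <;> simp only <;> linarith [hy.1, hy.2]
  · intro hx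
    exact ⟨(1 - x) / 2, ⟨by linarith [hx.2], by linarith [hx.1]⟩, by ring⟩

theorem hasDerivWithinAt_one_sub_two_mul (s : Set ℝ) (y : ℝ) :
    HasDerivWithinAt (fun y : ℝ => 1 - 2 * y) (-2) s y := by
  have h := ((hasDerivAt_id y).const_mul (2 : ℝ)).const_sub 1
  simpa using h.hasDerivWithinAt

theorem injOn_one_sub_two_mul (s : Set ℝ) : Set.InjOn (fun y : ℝ => 1 - 2 * y) s := by
  intro y _ z _ h
  simp only at h
  linarith

theorem beta_pos' {α β : ℝ} (hα : -1 < α) (hβ : -1 < β) :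
    0 < ProbabilityTheory.beta (α + 1) (β + 1) :=
  ProbabilityTheory.beta_pos (by linarith) (by linarith)

theorem jacobiDensity_one_sub_two_mul {α β y : ℝ} (hy : y ∈ Set.Ioo (0 : ℝ) 1) :
    2 * (1 / ((2 : ℝ) ^ (α + β + 1) * ProbabilityTheory.beta (α + 1) (β + 1)) *
        ((1 - (1 - 2 * y)) ^ α * (1 + (1 - 2 * y)) ^ β)) =
      1 / ProbabilityTheory.beta (α + 1) (β + 1) * (y ^ α * (1 - y) ^ β) := by
  rw [show 1 - (1 - 2 * y) = 2 * y by ring, show 1 + (1 - 2 * y) = 2 * (1 - y) by ring,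
    Real.mul_rpow (by norm_num) hy.1.le, Real.mul_rpow (by norm_num) (by linarith [hy.2]),
    Real.rpow_add (by norm_num), Real.rpow_add (by norm_num), Real.rpow_one]
  have h1 : (2 : ℝ) ^ α ≠ 0 := (Real.rpow_pos_of_pos (by norm_num) _).ne'
  have h2 : (2 : ℝ) ^ β ≠ 0 := (Real.rpow_pos_of_pos (by norm_num) _).ne'
  field_simp

/-- Integration against the Jacobi probability measure in the coordinate `y = (1 - x) / 2`. -/
theorem integral_jacobiMeasure {α β : ℝ} (hα : -1 < α) (hβ : -1 < β) (f : ℝ → ℝ) :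
    ∫ x, f x ∂(jacobiMeasure α β) = 1 / ProbabilityTheory.beta (α + 1) (β + 1) *
      ∫ y in Set.Ioo (0 : ℝ) 1, y ^ α * (1 - y) ^ β * f (1 - 2 * y) := by
  have hpos := beta_pos' hα hβ
  rw [jacobiMeasure, integral_withDensity_eq_integral_toReal_smul (by fun_prop)
    (Filter.Eventually.of_forall fun _ => ENNReal.ofReal_lt_top), ← image_one_sub_two_mul_Ioo,
    integral_image_eq_integral_abs_deriv_smul measurableSet_Ioo
      (fun y _ => hasDerivWithinAt_one_sub_two_mul _ y) (injOn_one_sub_two_mul _),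
    ← integral_const_mul]
  refine setIntegral_congr_fun measurableSet_Ioo (fun y hy => ?_)
  simp only [smul_eq_mul]
  have h := jacobiDensity_one_sub_two_mul (α := α) (β := β) hy
  have hnn : 0 ≤ 1 / ((2 : ℝ) ^ (α + β + 1) * ProbabilityTheory.beta (α + 1) (β + 1)) *
        ((1 - (1 - 2 * y)) ^ α * (1 + (1 - 2 * y)) ^ β) := by
    have h1 : 0 ≤ 1 - (1 - 2 * y) := by linarith [hy.1]
    have h2 : 0 ≤ 1 + (1 - 2 * y) := by linarith [hy.2]
    positivity
  rw [ENNReal.toReal_ofReal hnn, abs_neg, abs_two, ← mul_assoc, h]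
  ring

theorem integrableOn_jacobiDensity {α β : ℝ} (hα : -1 < α) (hβ : -1 < β) :
    IntegrableOn (fun x : ℝ => 1 / ((2 : ℝ) ^ (α + β + 1) *
      ProbabilityTheory.beta (α + 1) (β + 1)) * ((1 - x) ^ α * (1 + x) ^ β))
      (Set.Ioo (-1 : ℝ) 1) := by
  rw [← image_one_sub_two_mul_Ioo, integrableOn_image_iff_integrableOn_abs_deriv_smul
    measurableSet_Ioo (fun y _ => hasDerivWithinAt_one_sub_two_mul _ y) (injOn_one_sub_two_mul _)]
  refine IntegrableOn.congr_fun ((integrableOn_beta hα hβ).const_mul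
    (1 / ProbabilityTheory.beta (α + 1) (β + 1))) (fun y hy => ?_) measurableSet_Ioo
  simp only [smul_eq_mul]
  rw [abs_neg, abs_two, jacobiDensity_one_sub_two_mul hy]

theorem isProbabilityMeasure_jacobiMeasure {α β : ℝ} (hα : -1 < α) (hβ : -1 < β) :
    IsProbabilityMeasure (jacobiMeasure α β) := by
  have : IsFiniteMeasure (jacobiMeasure α β) :=
    isFiniteMeasure_withDensity_ofReal (integrableOn_jacobiDensity hα hβ).2
  have h := integral_jacobiMeasure hα hβ (fun _ => 1)
  simp only [mul_one, integral_beta hα hβ, integral_const, smul_eq_mul] at h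
  rw [one_div_mul_cancel (beta_pos' hα hβ).ne'] at h
  exact ⟨(ENNReal.toReal_eq_one_iff _).1 h⟩

theorem ae_jacobiMeasure_mem (α β : ℝ) :
    ∀ᵐ x ∂(jacobiMeasure α β), x ∈ Set.Ioo (-1 : ℝ) 1 :=
  (withDensity_absolutelyContinuous _ _).ae_le (ae_restrict_mem measurableSet_Ioo)

/-- Since the Jacobi measure is finite and lives on a bounded interval, continuous functions are
integrable. -/
theorem integrable_jacobiMeasure {α β : ℝ} (hα : -1 < α) (hβ : -1 < β) {f : ℝ → ℝ}
    (hf : Continuous f) : Integrable f (jacobiMeasure α β) := by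
  have := isProbabilityMeasure_jacobiMeasure hα hβ
  obtain ⟨M, hM⟩ := (isCompact_Icc (a := (-1 : ℝ)) (b := 1)).exists_bound_of_continuousOn
    hf.continuousOn
  refine Integrable.of_bound hf.aestronglyMeasurable M ?_
  filter_upwards [ae_jacobiMeasure_mem α β] with x hx
  exact hM x (Set.Ioo_subset_Icc_self hx)

theorem psi_eq (α β N : ℝ) : psi α β N = ENNReal.ofReal (1 / (N + 1)) •
    (jacobiMeasure α β + ENNReal.ofReal N • Measure.dirac (1 : ℝ)) := rfl

theorem integrable_psi {α β : ℝ} (hα : -1 < α) (hβ : -1 < β) (N : ℝ) {f : ℝ → ℝ}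
    (hf : Continuous f) : Integrable f (psi α β N) := by
  rw [psi_eq]
  refine Integrable.smul_measure ?_ ENNReal.ofReal_ne_top
  refine (integrable_jacobiMeasure hα hβ hf).add_measure
    (Integrable.smul_measure ?_ ENNReal.ofReal_ne_top)
  exact integrable_dirac (by simp)

theorem integral_psi {α β N : ℝ} (hα : -1 < α) (hβ : -1 < β) (hN : 0 < N) {f : ℝ → ℝ}
    (hf : Continuous f) : ∫ x, f x ∂(psi α β N) =
      1 / (N + 1) * (∫ x, f x ∂(jacobiMeasure α β) + N * f 1) := by
  rw [psi_eq, integral_smul_measure, integral_add_measure (integrable_jacobiMeasure hα hβ hf)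
    (Integrable.smul_measure (integrable_dirac (by simp)) ENNReal.ofReal_ne_top),
    integral_smul_measure, integral_dirac, ENNReal.toReal_ofReal (by positivity),
    ENNReal.toReal_ofReal hN.le]
  simp

/-- The mixed moments of the Jacobi measure in the coordinates `y = (1 - x) / 2` and `1 - y`. -/
theorem integral_jacobiMeasure_pow_mul_pow {α β : ℝ} (hα : -1 < α) (hβ : -1 < β) (k m : ℕ) :
    ∫ x, ((1 - x) / 2) ^ k * ((1 + x) / 2) ^ m ∂(jacobiMeasure α β) =
      poch (α + 1) k * poch (β + 1) m / poch (α + β + 2) (k + m) := by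
  have hG : ∀ (a : ℝ), 0 < a → ∀ n : ℕ, Real.Gamma (a + n) = poch a n * Real.Gamma a := by
    intro a ha n
    induction n with
    | zero => simp
    | succ n ih =>
      rw [Nat.cast_succ, ← add_assoc, Real.Gamma_add_one (by positivity), ih, poch_succ]
      ring
  rw [integral_jacobiMeasure hα hβ]
  have h : ∫ y in Set.Ioo (0 : ℝ) 1, y ^ α * (1 - y) ^ β *
        (((1 - (1 - 2 * y)) / 2) ^ k * ((1 + (1 - 2 * y)) / 2) ^ m) =
      ∫ y in Set.Ioo (0 : ℝ) 1, y ^ (α + k) * (1 - y) ^ (β + m) := by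
    refine setIntegral_congr_fun measurableSet_Ioo (fun y hy => ?_)
    rw [Real.rpow_add hy.1, Real.rpow_add (by linarith [hy.2]), Real.rpow_natCast,
      Real.rpow_natCast]
    ring
  have hk : (0 : ℝ) ≤ k := k.cast_nonneg
  have hm : (0 : ℝ) ≤ m := m.cast_nonneg
  rw [h, integral_beta (by linarith) (by linarith), ProbabilityTheory.beta,
    ProbabilityTheory.beta, show α + k + 1 = α + 1 + k by ring,
    show β + m + 1 = β + 1 + m by ring,
    show α + 1 + k + (β + 1 + m) = α + β + 2 + ((k + m : ℕ) : ℝ) by push_cast; ring,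
    show α + 1 + (β + 1) = α + β + 2 by ring, hG _ (by linarith), hG _ (by linarith),
    hG _ (by linarith)]
  have h1 := (Real.Gamma_pos_of_pos (show 0 < α + 1 by linarith)).ne'
  have h2 := (Real.Gamma_pos_of_pos (show 0 < β + 1 by linarith)).ne'
  have h3 := (Real.Gamma_pos_of_pos (show 0 < α + β + 2 by linarith)).ne'
  have h4 := poch_ne_zero (show 0 < α + β + 2 by linarith) (k + m)
  field_simp

/-! ### Orthogonality of Koornwinder's polynomials -/

/-- The coefficient of `((1 - x) / 2) ^ k` in `P_n^{α,β}`, up to the factor `(α+1)_n / n!`. -/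
def jacobiCoeff (α β : ℝ) (n k : ℕ) : ℝ :=
  (-1) ^ k * (n.choose k : ℝ) * (poch ((n : ℝ) + α + β + 1) k / poch (α + 1) k)

@[simp] theorem jacobiCoeff_zero (α β : ℝ) (n : ℕ) : jacobiCoeff α β n 0 = 1 := by
  simp [jacobiCoeff]

theorem jacobi_eq (α β : ℝ) (n : ℕ) : jacobi α β n =
    C (poch (α + 1) n / (n.factorial : ℝ)) * ∑ k ∈ Finset.range (n + 1),
      C (jacobiCoeff α β n k) * (C (1 / 2) * (1 - X)) ^ k := by
  rw [jacobi]
  congr 1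
  refine Finset.sum_congr rfl fun k _ => ?_
  rw [jacobiCoeff, poch_neg_eq_choose]
  have := Nat.factorial_ne_zero k
  congr 2
  field_simp

theorem eval_jacobi (α β : ℝ) (n : ℕ) (x : ℝ) : (jacobi α β n).eval x =
    poch (α + 1) n / (n.factorial : ℝ) * ∑ k ∈ Finset.range (n + 1),
      jacobiCoeff α β n k * ((1 - x) / 2) ^ k := by
  rw [jacobi_eq]
  simp only [eval_mul, eval_C, eval_finsetSum, eval_pow, eval_sub, eval_one, eval_X]
  simp only [one_div, inv_mul_eq_div]

theorem eval_derivative_jacobi (α β : ℝ) (n : ℕ) (x : ℝ) :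
    (1 + x) * (derivative (jacobi α β n)).eval x =
    -(poch (α + 1) n / (n.factorial : ℝ) * ∑ k ∈ Finset.range n,
      (k + 1) * jacobiCoeff α β n (k + 1) * (((1 - x) / 2) ^ k * ((1 + x) / 2))) := by
  rw [jacobi_eq, Finset.sum_range_succ']
  simp only [derivative_mul, derivative_C, derivative_add, derivative_sum, derivative_pow,
    derivative_sub, derivative_one, derivative_X, eval_mul, eval_C, eval_finsetSum, eval_pow,
    eval_sub, eval_one, eval_X, eval_add]
  simp only [zero_mul, zero_add, eval_zero, zero_sub, pow_zero, Nat.cast_zero,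
    mul_zero, add_zero, Nat.add_sub_cancel, Nat.cast_add, Nat.cast_one]
  rw [mul_left_comm, ← mul_neg, Finset.mul_sum, ← Finset.sum_neg_distrib]
  congr 1
  refine Finset.sum_congr rfl fun k _ => ?_
  simp only [one_div, inv_mul_eq_div]
  ring

theorem natDegree_jacobi_le (α β : ℝ) (n : ℕ) : (jacobi α β n).natDegree ≤ n := by
  rw [jacobi_eq]
  refine (natDegree_C_mul_le _ _).trans (natDegree_sum_le_of_forall_le _ _ fun k hk => ?_)
  refine (natDegree_C_mul_le _ _).trans (natDegree_pow_le.trans ?_)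
  have h1 : (C (1 / 2 : ℝ) * (1 - X)).natDegree ≤ 1 :=
    (natDegree_C_mul_le _ _).trans ((natDegree_sub_le _ _).trans (by simp))
  calc k * _ ≤ k * 1 := Nat.mul_le_mul_left _ h1
    _ ≤ n := by have := Finset.mem_range.1 hk; omega

theorem natDegree_Q_le (α β N : ℝ) (n : ℕ) : (Q α β N n).natDegree ≤ n := by
  rw [Q, koornwinder]
  refine (natDegree_C_mul_le _ _).trans ((natDegree_C_mul_le _ _).trans
    (natDegree_add_le_of_degree_le ?_
      ((natDegree_C_mul_le _ _).trans (natDegree_jacobi_le α β n))))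
  rcases Nat.eq_zero_or_pos n with rfl | hn
  · have h : derivative (jacobi α β 0) = 0 := by simp [jacobi_eq]
    simp [h]
  · have h1 : (-(C N : ℝ[X]) * (1 + X)).natDegree ≤ 1 := by
      rw [← C_neg]
      exact (natDegree_C_mul_le _ _).trans ((natDegree_add_le _ _).trans (by simp))
    have h2 : (derivative (jacobi α β n)).natDegree ≤ n - 1 :=
      (natDegree_derivative_le _).trans (Nat.sub_le_sub_right (natDegree_jacobi_le α β n) 1)
    exact (natDegree_mul_le_of_le h1 h2).trans (by omega)

theorem integral_sum_jacobiMeasure {α β : ℝ} (hα : -1 < α) (hβ : -1 < β) (n m : ℕ)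
    (a : ℕ → ℝ) :
    ∫ x, (∑ k ∈ Finset.range n, a k * (((1 - x) / 2) ^ k * ((1 + x) / 2) ^ m))
        ∂(jacobiMeasure α β) =
      ∑ k ∈ Finset.range n,
        a k * (poch (α + 1) k * poch (β + 1) m / poch (α + β + 2) (k + m)) := by
  rw [integral_finsetSum _ fun k _ => integrable_jacobiMeasure hα hβ (by fun_prop)]
  refine Finset.sum_congr rfl fun k _ => ?_
  rw [integral_const_mul, integral_jacobiMeasure_pow_mul_pow hα hβ]

/-- `P_n^{α,β}` is orthogonal to `(1 + x) ^ m` for `m < n`. -/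
theorem integral_jacobi_mul_pow {α β : ℝ} (hα : -1 < α) (hβ : -1 < β) {n m : ℕ} (hm : m < n) :
    ∫ x, (jacobi α β n).eval x * ((1 + x) / 2) ^ m ∂(jacobiMeasure α β) = 0 := by
  simp only [eval_jacobi, mul_assoc, integral_const_mul, Finset.sum_mul]
  rw [integral_sum_jacobiMeasure hα hβ]
  have hs : 0 < α + β + 2 := by linarith
  have hsm : 0 < α + β + 2 + m := by positivity
  have key := chu_vandermonde n ((n : ℝ) + α + β + 1) (α + β + 2 + m) hsm
  rw [show α + β + 2 + m - ((n : ℝ) + α + β + 1) = -((n - 1 - m : ℕ) : ℝ) by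
    rw [Nat.cast_sub (by omega), Nat.cast_sub (by omega)]; push_cast; ring,
    poch_neg_eq_zero (by omega), zero_div] at key
  have : ∀ k ∈ Finset.range (n + 1), jacobiCoeff α β n k *
      (poch (α + 1) k * poch (β + 1) m / poch (α + β + 2) (k + m)) =
      poch (β + 1) m / poch (α + β + 2) m * ((-1) ^ k * (n.choose k : ℝ) *
        (poch ((n : ℝ) + α + β + 1) k / poch (α + β + 2 + m) k)) := by
    intro k _
    rw [jacobiCoeff, add_comm k m, poch_add]
    have h1 := poch_ne_zero (show 0 < α + 1 by linarith) k
    have h2 := poch_ne_zero hs m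
    have h3 := poch_ne_zero hsm k
    field_simp
  rw [Finset.sum_congr rfl this, ← Finset.mul_sum, key]
  simp

/-- The top moment of `(1 + x) d/dx P_n`. The integral that arises loses its dependence on
`(n+α+β+1)_k`, which cancels against the moments of the weight. -/
theorem integral_derivative_jacobi_mul_pow_self {α β : ℝ} (hα : -1 < α) (hβ : -1 < β) (n : ℕ) :
    ∫ x, (1 + x) * (derivative (jacobi α β (n + 1))).eval x * ((1 + x) / 2) ^ n
        ∂(jacobiMeasure α β) = poch (β + 1) (n + 1) / poch (α + β + 2) n := by
  simp only [eval_derivative_jacobi, neg_mul, integral_neg, mul_assoc, integral_const_mul,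
    Finset.sum_mul]
  simp only [← mul_assoc, ← pow_succ']
  simp only [mul_assoc]
  simp only [← mul_assoc (_ + (1 : ℝ))]
  rw [integral_sum_jacobiMeasure hα hβ]
  have hs : 0 < α + β + 2 := by linarith
  have hsn : 0 < α + β + 2 + n := by positivity
  have ha : 0 < α + 1 := by linarith
  have key := chu_vandermonde n (α + 1) (α + 1 + 1) (by linarith)
  rw [show α + 1 + 1 - (α + 1) = 1 by ring, poch_one_eq_factorial] at key
  have : ∀ k ∈ Finset.range (n + 1), ((k : ℝ) + 1) * jacobiCoeff α β (n + 1) (k + 1) *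
      (poch (α + 1) k * poch (β + 1) (n + 1) / poch (α + β + 2) (k + (n + 1))) =
      -(((n : ℝ) + 1) / (α + 1)) * (poch (β + 1) (n + 1) / poch (α + β + 2) n) *
        ((-1) ^ k * (n.choose k : ℝ) * (poch (α + 1) k / poch (α + 1 + 1) k)) := by
    intro k _
    have hch : ((n + 1).choose (k + 1) : ℝ) * (k + 1) = (n + 1) * n.choose k := by
      exact_mod_cast (Nat.add_one_mul_choose_eq n k).symm
    have h0 : poch (α + 1) k * (α + 1 + k) = (α + 1) * poch (α + 1 + 1) k := by
      rw [← poch_succ, poch_succ_left]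
    rw [jacobiCoeff, show k + (n + 1) = n + (k + 1) by ring, poch_add (α + β + 2) n,
      show ((n + 1 : ℕ) : ℝ) + α + β + 1 = α + β + 2 + n by push_cast; ring,
      poch_succ_left (α + 1) k]
    have h1 := poch_ne_zero ha k
    have h2 := poch_ne_zero (show 0 < α + 1 + 1 by linarith) k
    have h3 := poch_ne_zero hs n
    have h4 := poch_ne_zero hsn (k + 1)
    field_simp
    linear_combination (-1) ^ (k + 1) * poch (β + 1) (n + 1) * hch
  rw [Finset.sum_congr rfl this, ← Finset.mul_sum, key, poch_succ_left (α + 1) n,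
    Nat.factorial_succ]
  have h1 := poch_ne_zero (show 0 < α + 1 + 1 by linarith) n
  have h2 := poch_ne_zero hs n
  have h3 : (n.factorial : ℝ) ≠ 0 := by exact_mod_cast Nat.factorial_ne_zero n
  push_cast
  field_simp

/-- `(1 - x²) d/dx P_n`, a multiple of `(1 - x²) P_{n-1}^{α+1,β+1}`, is orthogonal to `(1 + x) ^ m`
for `m < n - 1`. -/
theorem integral_derivative_jacobi_mul_pow_sub {α β : ℝ} (hα : -1 < α) (hβ : -1 < β) {n m : ℕ}
    (hm : m < n) :
    ∫ x, (1 + x) * (derivative (jacobi α β (n + 1))).eval x *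
      (((1 - x) / 2) * ((1 + x) / 2) ^ m) ∂(jacobiMeasure α β) = 0 := by
  have hx : ∀ x : ℝ, (1 + x) * (derivative (jacobi α β (n + 1))).eval x *
      (((1 - x) / 2) * ((1 + x) / 2) ^ m) =
      -(poch (α + 1) (n + 1) / ((n + 1).factorial : ℝ)) * ∑ k ∈ Finset.range (n + 2),
        k * jacobiCoeff α β (n + 1) k * (((1 - x) / 2) ^ k * ((1 + x) / 2) ^ (m + 1)) := by
    intro x
    rw [eval_derivative_jacobi, Finset.sum_range_succ' _ (n + 1)]
    simp only [Nat.cast_zero, zero_mul, add_zero]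
    rw [neg_mul, neg_mul, mul_assoc, Finset.sum_mul]
    congr 2
    refine Finset.sum_congr rfl fun k _ => ?_
    push_cast
    ring
  simp only [hx, integral_const_mul]
  rw [integral_sum_jacobiMeasure hα hβ, Finset.sum_range_succ']
  simp only [Nat.cast_zero, zero_mul, add_zero]
  have hs : 0 < α + β + 2 := by linarith
  have ha : 0 < α + 1 := by linarith
  have hsm : 0 < α + β + m + 4 := by have : (0 : ℝ) ≤ m := m.cast_nonneg; linarith
  have key := chu_vandermonde n ((n : ℝ) + α + β + 3) (α + β + m + 4) hsm
  rw [show α + β + m + 4 - ((n : ℝ) + α + β + 3) = -((n - 1 - m : ℕ) : ℝ) by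
    rw [Nat.cast_sub (by omega), Nat.cast_sub (by omega)]; push_cast; ring,
    poch_neg_eq_zero (by omega), zero_div] at key
  have : ∀ k ∈ Finset.range (n + 1), ((k + 1 : ℕ) : ℝ) * jacobiCoeff α β (n + 1) (k + 1) *
      (poch (α + 1) (k + 1) * poch (β + 1) (m + 1) / poch (α + β + 2) (k + 1 + (m + 1))) =
      -((n : ℝ) + 1) * ((n : ℝ) + α + β + 2) * poch (β + 1) (m + 1) / poch (α + β + 2) (m + 2) *
        ((-1) ^ k * (n.choose k : ℝ) *
          (poch ((n : ℝ) + α + β + 3) k / poch (α + β + m + 4) k)) := by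
    intro k _
    have hch : ((n + 1).choose (k + 1) : ℝ) * (k + 1) = (n + 1) * n.choose k := by
      exact_mod_cast (Nat.add_one_mul_choose_eq n k).symm
    rw [jacobiCoeff, show k + 1 + (m + 1) = m + 2 + k by ring, poch_add (α + β + 2) (m + 2),
      show ((n + 1 : ℕ) : ℝ) + α + β + 1 = n + α + β + 2 by push_cast; ring,
      poch_succ_left (n + α + β + 2) k, show (n : ℝ) + α + β + 2 + 1 = n + α + β + 3 by ring,
      show α + β + 2 + ((m + 2 : ℕ) : ℝ) = α + β + m + 4 by push_cast; ring]
    have h1 := poch_ne_zero ha (k + 1)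
    have h3 := poch_ne_zero hs (m + 2)
    have h4 := poch_ne_zero hsm k
    field_simp
    push_cast
    linear_combination (-1) ^ (k + 1) * (n + α + β + 2) * poch (n + α + β + 3) k *
      poch (β + 1) (m + 1) * hch
  rw [Finset.sum_congr rfl this, ← Finset.mul_sum, key]
  simp

/-- The moments `E[(1 + x) P_n' ((1 + x) / 2) ^ m]` do not depend on `m` in the range `m < n`.
This is what lets the point mass at `1` compensate all of them at once. -/
theorem integral_derivative_jacobi_mul_pow {α β : ℝ} (hα : -1 < α) (hβ : -1 < β) {n m : ℕ}
    (hm : m ≤ n) :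
    ∫ x, (1 + x) * (derivative (jacobi α β (n + 1))).eval x * ((1 + x) / 2) ^ m
        ∂(jacobiMeasure α β) = poch (β + 1) (n + 1) / poch (α + β + 2) n := by
  induction hm using Nat.decreasingInduction with
  | self => exact integral_derivative_jacobi_mul_pow_self hα hβ n
  | of_succ m hm ih =>
    rw [← ih, ← sub_eq_zero, ← integral_sub (integrable_jacobiMeasure hα hβ (by fun_prop))
      (integrable_jacobiMeasure hα hβ (by fun_prop)),
      ← integral_derivative_jacobi_mul_pow_sub hα hβ hm]
    refine integral_congr_ae (Filter.Eventually.of_forall fun x => ?_)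
    simp only
    ring

theorem eval_one_jacobi (α β : ℝ) (n : ℕ) :
    (jacobi α β n).eval 1 = poch (α + 1) n / (n.factorial : ℝ) := by
  rw [eval_jacobi, Finset.sum_range_succ']
  simp

/-- The value at `1` of `[-N (1 + x) d/dx + B_n] P_n`. -/
theorem eval_one_operator_jacobi {α β : ℝ} (hα : -1 < α) (N : ℝ) (n : ℕ) :
    (-(C N) * (1 + X) * derivative (jacobi α β n) +
      C (coeffB α β N n) * jacobi α β n : ℝ[X]).eval 1 =
      poch (β + 1) n / poch (α + β + 2) (n - 1) := by
  have ha : 0 < α + 1 := by linarith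
  have h1 := poch_ne_zero ha n
  have h2 : (n.factorial : ℝ) ≠ 0 := by exact_mod_cast Nat.factorial_ne_zero n
  have hd : (1 + 1) * (derivative (jacobi α β n)).eval 1 =
      poch (α + 1) n / (n.factorial : ℝ) * ((n : ℝ) * ((n : ℝ) + α + β + 1) / (α + 1)) := by
    rw [eval_derivative_jacobi]
    rcases n with - | n
    · simp
    · rw [Finset.sum_range_succ']
      simp [jacobiCoeff]
      ring
  simp only [eval_add, eval_mul, eval_neg, eval_C, eval_one, eval_X, eval_one_jacobi]
  rw [mul_assoc, hd, coeffB]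
  field_simp
  ring

/-- The normalization `Q_n(1) = 1`. -/
theorem eval_one_Q {α β : ℝ} (hα : -1 < α) (hβ : -1 < β) (N : ℝ) (n : ℕ) :
    (Q α β N n).eval 1 = 1 := by
  rw [Q, koornwinder, eval_mul, eval_mul, eval_one_operator_jacobi hα, eval_C, eval_C, coeffA]
  have h1 := poch_ne_zero (show 0 < α + 1 by linarith) n
  have h2 := poch_ne_zero (show 0 < β + 1 by linarith) n
  have h3 := poch_ne_zero (show 0 < α + β + 2 by linarith) (n - 1)
  have h4 : (n.factorial : ℝ) ≠ 0 := by exact_mod_cast Nat.factorial_ne_zero n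
  field_simp

theorem integral_Q_mul_pow {α β N : ℝ} (hα : -1 < α) (hβ : -1 < β) (hN : 0 < N) {n m : ℕ}
    (hm : m < n) :
    ∫ x, (Q α β N n).eval x * ((1 + x) / 2) ^ m ∂(psi α β N) = 0 := by
  obtain ⟨n, rfl⟩ : ∃ n', n = n' + 1 := ⟨n - 1, by omega⟩
  rw [integral_psi hα hβ hN (by fun_prop)]
  have hT := eval_one_operator_jacobi (β := β) hα N (n + 1)
  simp only [eval_add, eval_mul, eval_neg, eval_C, eval_one, eval_X, Nat.add_sub_cancel] at hT
  simp only [Q, koornwinder, eval_add, eval_mul, eval_neg, eval_C, eval_one, eval_X]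
  have hx : ∀ x : ℝ, ((n + 1).factorial : ℝ) / poch (α + 1) (n + 1) *
      (poch (α + β + 2) (n + 1 - 1) / ((n + 1).factorial : ℝ) * coeffA α β (n + 1) *
        (-N * (1 + x) * (derivative (jacobi α β (n + 1))).eval x +
          coeffB α β N (n + 1) * (jacobi α β (n + 1)).eval x)) * ((1 + x) / 2) ^ m =
      ((n + 1).factorial : ℝ) / poch (α + 1) (n + 1) *
        (poch (α + β + 2) (n + 1 - 1) / ((n + 1).factorial : ℝ) * coeffA α β (n + 1)) *
        (-N * ((1 + x) * (derivative (jacobi α β (n + 1))).eval x * ((1 + x) / 2) ^ m) +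
          coeffB α β N (n + 1) * ((jacobi α β (n + 1)).eval x * ((1 + x) / 2) ^ m)) :=
    fun x => by ring
  simp only [hx, integral_const_mul]
  rw [integral_add (integrable_jacobiMeasure hα hβ (by fun_prop))
    (integrable_jacobiMeasure hα hβ (by fun_prop)), integral_const_mul, integral_const_mul,
    integral_derivative_jacobi_mul_pow hα hβ (Nat.lt_succ_iff.1 hm),
    integral_jacobi_mul_pow hα hβ hm, ← hT]
  ring

/-- `Q_n` is orthogonal to all polynomials of lower degree. -/
theorem integral_Q_mul_eval_eq_zero {α β N : ℝ} (hα : -1 < α) (hβ : -1 < β) (hN : 0 < N)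
    {n : ℕ} {f : ℝ[X]} (hf : f.natDegree < n) :
    ∫ x, (Q α β N n).eval x * f.eval x ∂(psi α β N) = 0 := by
  -- expansion of `f` in powers of `(1 + x) / 2`
  set g : ℝ[X] := f.comp (C 2 * X - C 1) with hg
  have hgd : g.natDegree < n := by
    refine lt_of_le_of_lt natDegree_comp_le ?_
    have : (C 2 * X - C 1 : ℝ[X]).natDegree = 1 := by
      rw [natDegree_sub_C, natDegree_C_mul_X _ two_ne_zero]
    rwa [this, mul_one]
  have hfg : ∀ x : ℝ, (Q α β N n).eval x * f.eval x = ∑ k ∈ Finset.range n,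
      g.coeff k * ((Q α β N n).eval x * ((1 + x) / 2) ^ k) := by
    intro x
    have : f.eval x = g.eval ((1 + x) / 2) := by
      rw [hg, eval_comp]
      simp only [eval_sub, eval_mul, eval_C, eval_X]
      congr 1
      ring
    rw [this, eval_eq_sum_range' hgd, Finset.mul_sum]
    exact Finset.sum_congr rfl fun k _ => by ring
  simp only [hfg]
  rw [integral_finsetSum _ fun k _ => integrable_psi hα hβ N (by fun_prop)]
  refine Finset.sum_eq_zero fun k hk => ?_
  rw [integral_const_mul, integral_Q_mul_pow hα hβ hN (Finset.mem_range.1 hk), mul_zero]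

/-! ### Fourier expansion and the three term recursion -/

/-- The inner product of two polynomials in `L²(psi)`. -/
def psiInner (α β N : ℝ) (f g : ℝ[X]) : ℝ := ∫ x, f.eval x * g.eval x ∂(psi α β N)

/-- The squared norm of `Q_n` in `L²(psi)`. -/
def normSqQ (α β N : ℝ) (n : ℕ) : ℝ := psiInner α β N (Q α β N n) (Q α β N n)

section

variable {α β N : ℝ}

theorem psiInner_comm (f g : ℝ[X]) : psiInner α β N f g = psiInner α β N g f := by
  simp only [psiInner, mul_comm]

theorem psiInner_C_mul_left (c : ℝ) (f g : ℝ[X]) :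
    psiInner α β N (C c * f) g = c * psiInner α β N f g := by
  simp only [psiInner, eval_mul, eval_C, mul_assoc, integral_const_mul]

theorem psiInner_C_mul_right (c : ℝ) (f g : ℝ[X]) :
    psiInner α β N f (C c * g) = c * psiInner α β N f g := by
  rw [psiInner_comm, psiInner_C_mul_left, psiInner_comm]

theorem psiInner_mul_left (h f g : ℝ[X]) :
    psiInner α β N (h * f) g = psiInner α β N f (h * g) := by
  simp only [psiInner, eval_mul, mul_left_comm, mul_assoc]

theorem psiInner_sum_left (hα : -1 < α) (hβ : -1 < β) {ι : Type*} (s : Finset ι)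
    (f : ι → ℝ[X]) (g : ℝ[X]) :
    psiInner α β N (∑ i ∈ s, f i) g = ∑ i ∈ s, psiInner α β N (f i) g := by
  simp only [psiInner, eval_finsetSum, Finset.sum_mul]
  exact integral_finsetSum _ fun k _ => integrable_psi hα hβ N (by fun_prop)

theorem psiInner_sum_right (hα : -1 < α) (hβ : -1 < β) {ι : Type*} (s : Finset ι)
    (f : ι → ℝ[X]) (g : ℝ[X]) :
    psiInner α β N g (∑ i ∈ s, f i) = ∑ i ∈ s, psiInner α β N g (f i) := by
  rw [psiInner_comm, psiInner_sum_left hα hβ]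
  simp only [psiInner_comm]

theorem psiInner_eq (hα : -1 < α) (hβ : -1 < β) (hN : 0 < N) (f g : ℝ[X]) :
    psiInner α β N f g = 1 / (N + 1) * (∫ x, f.eval x * g.eval x ∂(jacobiMeasure α β) +
      N * (f.eval 1 * g.eval 1)) :=
  integral_psi hα hβ hN (by fun_prop)

/-- The atom at `1` bounds the norm from below. -/
theorem le_psiInner_self (hα : -1 < α) (hβ : -1 < β) (hN : 0 < N) (f : ℝ[X]) :
    N / (N + 1) * f.eval 1 ^ 2 ≤ psiInner α β N f f := by
  rw [psiInner_eq hα hβ hN]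
  have h : 0 ≤ ∫ x, f.eval x * f.eval x ∂(jacobiMeasure α β) :=
    integral_nonneg fun x => mul_self_nonneg _
  have h2 : 0 ≤ 1 / (N + 1) * ∫ x, f.eval x * f.eval x ∂(jacobiMeasure α β) := by positivity
  calc _ = 1 / (N + 1) * (N * (f.eval 1 * f.eval 1)) := by ring
    _ ≤ _ := by rw [mul_add]; linarith

theorem normSqQ_pos (hα : -1 < α) (hβ : -1 < β) (hN : 0 < N) (n : ℕ) :
    0 < normSqQ α β N n := by
  refine lt_of_lt_of_le ?_ (le_psiInner_self hα hβ hN _)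
  rw [eval_one_Q hα hβ]
  positivity

theorem psiInner_Q_eq_zero (hα : -1 < α) (hβ : -1 < β) (hN : 0 < N) {n : ℕ} {f : ℝ[X]}
    (hf : f.natDegree < n) : psiInner α β N f (Q α β N n) = 0 := by
  rw [psiInner_comm]
  exact integral_Q_mul_eval_eq_zero hα hβ hN hf

theorem psiInner_Q_Q_of_ne (hα : -1 < α) (hβ : -1 < β) (hN : 0 < N) {m n : ℕ} (h : m ≠ n) :
    psiInner α β N (Q α β N m) (Q α β N n) = 0 := by
  rcases h.lt_or_gt with h | h
  · exact psiInner_Q_eq_zero hα hβ hN ((natDegree_Q_le α β N m).trans_lt h)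
  · rw [psiInner_comm]
    exact psiInner_Q_eq_zero hα hβ hN ((natDegree_Q_le α β N n).trans_lt h)

theorem natDegree_Q (hα : -1 < α) (hβ : -1 < β) (hN : 0 < N) (n : ℕ) :
    (Q α β N n).natDegree = n := by
  -- otherwise `Q_n` would be orthogonal to itself
  refine le_antisymm (natDegree_Q_le α β N n) (not_lt.1 fun h => ?_)
  exact (normSqQ_pos hα hβ hN n).ne' (psiInner_Q_eq_zero hα hβ hN h)

theorem Q_zero : Q α β N 0 = 1 := by
  simp [Q, koornwinder, coeffA, coeffB, jacobi_eq]

theorem exists_eq_sum_Q (hα : -1 < α) (hβ : -1 < β) (hN : 0 < N) (n : ℕ) (f : ℝ[X])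
    (hf : f.natDegree < n + 1) :
    ∃ a : ℕ → ℝ, f = ∑ k ∈ Finset.range (n + 1), C (a k) * Q α β N k := by
  induction n generalizing f with
  | zero =>
    refine ⟨fun _ => f.coeff 0, ?_⟩
    rw [Finset.sum_range_one, Q_zero, mul_one]
    exact eq_C_of_natDegree_eq_zero (by omega)
  | succ n ih =>
    have hl : (Q α β N (n + 1)).coeff (n + 1) ≠ 0 := by
      have h := natDegree_Q hα hβ hN (n + 1)
      have h0 : Q α β N (n + 1) ≠ 0 := by
        intro h0
        rw [h0, natDegree_zero] at h
        omega
      have h1 := leadingCoeff_ne_zero.2 h0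
      rwa [leadingCoeff, h] at h1
    set c := f.coeff (n + 1) / (Q α β N (n + 1)).coeff (n + 1) with hc
    have hd : (f - C c * Q α β N (n + 1)).natDegree < n + 1 := by
      rw [Nat.lt_succ_iff, natDegree_le_iff_coeff_eq_zero]
      intro m hm
      rw [coeff_sub, coeff_C_mul]
      rcases (Nat.succ_le_of_lt hm).eq_or_lt with rfl | hm
      · rw [hc]
        field_simp
        ring
      · rw [coeff_eq_zero_of_natDegree_lt (show f.natDegree < m by omega),
          coeff_eq_zero_of_natDegree_lt (show (Q α β N (n + 1)).natDegree < m by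
            rw [natDegree_Q hα hβ hN]; exact hm)]
        ring
    obtain ⟨a, ha⟩ := ih _ hd
    refine ⟨Function.update a (n + 1) c, ?_⟩
    rw [Finset.sum_range_succ, Function.update_self,
      Finset.sum_congr rfl (g := fun k => C (a k) * Q α β N k), ← ha]
    · ring
    · intro k hk
      rw [Function.update_of_ne (Finset.mem_range.1 hk).ne]

theorem psiInner_sum_Q (hα : -1 < α) (hβ : -1 < β) (hN : 0 < N) (s : Finset ℕ) (a : ℕ → ℝ)
    {m : ℕ} (hm : m ∈ s) :
    psiInner α β N (∑ k ∈ s, C (a k) * Q α β N k) (Q α β N m) = a m * normSqQ α β N m := by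
  rw [psiInner_sum_left hα hβ, Finset.sum_eq_single m]
  · rw [psiInner_C_mul_left, normSqQ]
  · intro k _ hk
    rw [psiInner_C_mul_left, psiInner_Q_Q_of_ne hα hβ hN hk, mul_zero]
  · exact fun h => absurd hm h

/-- Parseval's identity for finite expansions. -/
theorem psiInner_sum_Q_self (hα : -1 < α) (hβ : -1 < β) (hN : 0 < N) (s : Finset ℕ)
    (a : ℕ → ℝ) :
    psiInner α β N (∑ k ∈ s, C (a k) * Q α β N k) (∑ k ∈ s, C (a k) * Q α β N k) =
      ∑ k ∈ s, a k ^ 2 * normSqQ α β N k := by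
  rw [psiInner_sum_right hα hβ]
  refine Finset.sum_congr rfl fun k hk => ?_
  rw [psiInner_C_mul_right, psiInner_sum_Q hα hβ hN s a hk]
  ring

theorem eq_sum_Q (hα : -1 < α) (hβ : -1 < β) (hN : 0 < N) {n : ℕ} {f : ℝ[X]}
    (hf : f.natDegree < n + 1) :
    f = ∑ k ∈ Finset.range (n + 1),
      C (psiInner α β N f (Q α β N k) / normSqQ α β N k) * Q α β N k := by
  obtain ⟨a, ha⟩ := exists_eq_sum_Q hα hβ hN n f hf
  nth_rewrite 1 [ha]
  refine Finset.sum_congr rfl fun k hk => ?_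
  have h := psiInner_sum_Q hα hβ hN _ a hk
  rw [← ha] at h
  rw [h, mul_div_cancel_right₀ _ (normSqQ_pos hα hβ hN k).ne']

theorem expansionCoeff_eq (i n : ℕ) : expansionCoeff α β N i n =
    psiInner α β N (X * Q α β N i) (Q α β N n) / normSqQ α β N n := by
  simp only [expansionCoeff, psiInner, normSqQ, eval_mul, eval_X, sq]

theorem natDegree_X_mul_Q_lt (i : ℕ) : (X * Q α β N i).natDegree < i + 1 + 1 := by
  have h := natDegree_mul_le_of_le (natDegree_X_le (R := ℝ)) (natDegree_Q_le α β N i)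
  omega

theorem expansionCoeff_eq_zero (hα : -1 < α) (hβ : -1 < β) (hN : 0 < N) {i n : ℕ}
    (h : n + 1 < i) : expansionCoeff α β N i n = 0 := by
  rw [expansionCoeff_eq, psiInner_mul_left, psiInner_comm,
    psiInner_Q_eq_zero hα hβ hN, zero_div]
  have := natDegree_X_mul_Q_lt (α := α) (β := β) (N := N) n
  omega

/-- The three term recursion. -/
theorem X_mul_Q (hα : -1 < α) (hβ : -1 < β) (hN : 0 < N) (i : ℕ) :
    X * Q α β N i = C (p α β N i) * Q α β N (i + 1) + C (r α β N i) * Q α β N i +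
      C (q α β N i) * Q α β N (i - 1) := by
  have h := eq_sum_Q hα hβ hN (natDegree_X_mul_Q_lt (α := α) (β := β) (N := N) i)
  simp only [← expansionCoeff_eq] at h
  rw [Finset.sum_range_succ, Finset.sum_range_succ] at h
  rw [h]
  rcases i with - | i
  · simp [p, r, q]
    ring
  · rw [Finset.sum_range_succ, Finset.sum_eq_zero]
    · simp only [p, r, q, Nat.add_sub_cancel]
      ring
    · intro k hk
      rw [expansionCoeff_eq_zero hα hβ hN (by have := Finset.mem_range.1 hk; omega), C_0, zero_mul]

theorem p_add_r_add_q (hα : -1 < α) (hβ : -1 < β) (hN : 0 < N) (i : ℕ) :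
    p α β N i + r α β N i + q α β N i = 1 := by
  have h := congrArg (eval 1) (X_mul_Q hα hβ hN i)
  simp only [eval_mul, eval_add, eval_C, eval_X, eval_one_Q hα hβ, mul_one] at h
  exact h.symm

theorem p_mul_normSqQ (hα : -1 < α) (hβ : -1 < β) (hN : 0 < N) (n : ℕ) :
    p α β N n * normSqQ α β N (n + 1) = q α β N (n + 1) * normSqQ α β N n := by
  rw [p, q, expansionCoeff_eq, expansionCoeff_eq,
    div_mul_cancel₀ _ (normSqQ_pos hα hβ hN _).ne', div_mul_cancel₀ _ (normSqQ_pos hα hβ hN _).ne',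
    psiInner_mul_left, psiInner_comm]

theorem normSqQ_zero (hα : -1 < α) (hβ : -1 < β) (hN : 0 < N) : normSqQ α β N 0 = 1 := by
  have := isProbabilityMeasure_jacobiMeasure hα hβ
  rw [normSqQ, Q_zero, psiInner_eq hα hβ hN]
  simp
  field_simp
  ring

/-- The reversibility function is `1 / ‖Q_n‖²`. -/
theorem revMeasure_eq (hα : -1 < α) (hβ : -1 < β) (hN : 0 < N)
    (hq : ∀ n, 1 ≤ n → 0 < q α β N n) (n : ℕ) :
    revMeasure α β N n = 1 / normSqQ α β N n := by
  induction n with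
  | zero => simp [revMeasure, normSqQ_zero hα hβ hN]
  | succ n ih =>
    have h : revMeasure α β N (n + 1) =
        revMeasure α β N n * (p α β N n / q α β N (n + 1)) := by
      rw [revMeasure, revMeasure, Finset.prod_range_succ, Finset.prod_range_succ,
        mul_div_mul_comm]
    have h1 := (normSqQ_pos hα hβ hN n).ne'
    have h2 := (normSqQ_pos hα hβ hN (n + 1)).ne'
    have h3 := (hq (n + 1) (by omega)).ne'
    rw [h, ih]
    field_simp
    rw [p_mul_normSqQ hα hβ hN n, mul_comm]

end

/-! ### Decay of the moments -/

/-- A Laplace type estimate: only a neighbourhood of `y = 0` contributes to the decay of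
`∫ y^α (1 - y)^β (1 - δ y)^t`, the rest being exponentially small. -/
theorem exists_integral_beta_mul_pow_le {α β δ : ℝ} (hα : -1 < α) (hβ : -1 < β) (hδ : 0 < δ)
    (hδ1 : δ ≤ 1) :
    ∃ C : ℝ, 0 ≤ C ∧ ∀ t : ℕ,
      ∫ y in Set.Ioo (0 : ℝ) 1, y ^ α * (1 - y) ^ β * (1 - δ * y) ^ t ≤
        C / ((t : ℝ) + 1) ^ (1 + α) := by
  have ha : 0 < 1 + α := by linarith
  have hb := beta_pos' hα hβ
  have hG := Real.Gamma_pos_of_pos ha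
  refine ⟨Real.exp δ * ((2 : ℝ) ^ |β| * (Real.Gamma (1 + α) / δ ^ (1 + α)) +
    (2 * (1 + α) / δ) ^ (1 + α) * ProbabilityTheory.beta (α + 1) (β + 1)), by positivity,
    fun t => ?_⟩
  set s : ℝ := (t : ℝ) + 1 with hs
  have hs0 : 0 < s := by positivity
  have hspos : 0 < s ^ (1 + α) := Real.rpow_pos_of_pos hs0 _
  -- the exponential factor away from the singularity
  have hexp : Real.exp (-(δ * s / 2)) ≤ (2 * (1 + α) / δ) ^ (1 + α) / s ^ (1 + α) := by
    have h1 : δ * s / (2 * (1 + α)) ≤ Real.exp (δ * s / (2 * (1 + α))) := by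
      have := Real.add_one_le_exp (δ * s / (2 * (1 + α)))
      linarith
    have h2 := Real.rpow_le_rpow (by positivity) h1 ha.le
    rw [← Real.exp_mul, show δ * s / (2 * (1 + α)) * (1 + α) = δ * s / 2 by field_simp,
      show δ * s / (2 * (1 + α)) = s / (2 * (1 + α) / δ) by field_simp,
      Real.div_rpow hs0.le (by positivity)] at h2
    rw [Real.exp_neg, inv_le_comm₀ (Real.exp_pos _) (by positivity), inv_div]
    exact h2
  have hpt : ∀ y ∈ Set.Ioo (0 : ℝ) 1, y ^ α * (1 - y) ^ β * (1 - δ * y) ^ t ≤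
      Real.exp δ * ((2 : ℝ) ^ |β| * (y ^ (1 + α - 1) * Real.exp (-(δ * s * y))) +
        Real.exp (-(δ * s / 2)) * (y ^ α * (1 - y) ^ β)) := by
    rintro y ⟨hy0, hy1⟩
    have hδy : δ * y ≤ 1 := by nlinarith
    have hyα : 0 < y ^ α := Real.rpow_pos_of_pos hy0 _
    have hyβ : 0 < (1 - y) ^ β := Real.rpow_pos_of_pos (by linarith) _
    have h1 : (1 - δ * y) ^ t ≤ Real.exp δ * Real.exp (-(δ * s * y)) := by
      have h : 1 - δ * y ≤ Real.exp (-(δ * y)) := by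
        have := Real.add_one_le_exp (-(δ * y))
        linarith
      calc (1 - δ * y) ^ t ≤ Real.exp (-(δ * y)) ^ t :=
            pow_le_pow_left₀ (by linarith) h t
        _ = Real.exp (δ * y + -(δ * s * y)) := by
            rw [← Real.exp_nat_mul, hs]
            congr 1
            ring
        _ ≤ Real.exp (δ + -(δ * s * y)) := Real.exp_le_exp.2 (by nlinarith)
        _ = _ := Real.exp_add _ _
    rw [show 1 + α - 1 = α by ring]
    have hmain : (1 - y) ^ β * Real.exp (-(δ * s * y)) ≤
        (2 : ℝ) ^ |β| * Real.exp (-(δ * s * y)) + Real.exp (-(δ * s / 2)) * (1 - y) ^ β := by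
      rcases le_total y (1 / 2) with hy | hy
      · have h2 : (1 - y) ^ β ≤ (2 : ℝ) ^ |β| := by
          rcases le_total 0 β with hβ0 | hβ0
          · calc (1 - y) ^ β ≤ 1 := Real.rpow_le_one (by linarith) (by linarith) hβ0
              _ ≤ _ := Real.one_le_rpow (by norm_num) (abs_nonneg _)
          · rw [abs_of_nonpos hβ0, Real.rpow_neg (by norm_num), ← Real.inv_rpow (by norm_num)]
            exact Real.rpow_le_rpow_of_nonpos (by norm_num) (by linarith) hβ0
        have h3 := mul_le_mul_of_nonneg_right h2 (Real.exp_pos (-(δ * s * y))).le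
        have h4 : 0 ≤ Real.exp (-(δ * s / 2)) * (1 - y) ^ β := by positivity
        linarith
      · have h3 : Real.exp (-(δ * s * y)) ≤ Real.exp (-(δ * s / 2)) := by
          refine Real.exp_le_exp.2 ?_
          have : 0 < δ * s := by positivity
          nlinarith
        have h4 := mul_le_mul_of_nonneg_left h3 hyβ.le
        have h5 : 0 ≤ (2 : ℝ) ^ |β| * Real.exp (-(δ * s * y)) := by positivity
        linarith
    calc y ^ α * (1 - y) ^ β * (1 - δ * y) ^ t
        ≤ y ^ α * (1 - y) ^ β * (Real.exp δ * Real.exp (-(δ * s * y))) :=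
          mul_le_mul_of_nonneg_left h1 (by positivity)
      _ = Real.exp δ * y ^ α * ((1 - y) ^ β * Real.exp (-(δ * s * y))) := by ring
      _ ≤ Real.exp δ * y ^ α * _ := mul_le_mul_of_nonneg_left hmain (by positivity)
      _ = _ := by ring
  have hint := integrableOn_beta hα hβ
  have hgamma : IntegrableOn (fun y : ℝ => y ^ (1 + α - 1) * Real.exp (-(δ * s * y)))
      (Set.Ioi 0) := by
    have := Real.integral_rpow_mul_exp_neg_mul_Ioi ha (show 0 < δ * s by positivity)
    refine not_imp_comm.1 integral_undef ?_
    rw [this]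
    positivity
  have hle : ∫ y in Set.Ioo (0 : ℝ) 1, y ^ (1 + α - 1) * Real.exp (-(δ * s * y)) ≤
      Real.Gamma (1 + α) / δ ^ (1 + α) / s ^ (1 + α) := by
    have h := Real.integral_rpow_mul_exp_neg_mul_Ioi ha (show 0 < δ * s by positivity)
    rw [Real.div_rpow zero_le_one (by positivity), Real.one_rpow,
      Real.mul_rpow hδ.le hs0.le] at h
    have h2 : Real.Gamma (1 + α) / δ ^ (1 + α) / s ^ (1 + α) =
        1 / (δ ^ (1 + α) * s ^ (1 + α)) * Real.Gamma (1 + α) := by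
      rw [div_div]
      ring
    rw [h2, ← h]
    refine setIntegral_mono_set hgamma ?_ Set.Ioo_subset_Ioi_self.eventuallyLE
    refine ae_restrict_of_forall_mem measurableSet_Ioi fun y hy => ?_
    have : 0 < y ^ (1 + α - 1) := Real.rpow_pos_of_pos hy _
    simp only [Pi.zero_apply]
    positivity
  have hgamma' := hgamma.mono_set (show Set.Ioo (0 : ℝ) 1 ⊆ Set.Ioi 0 from fun y hy => hy.1)
  have hnn : ∀ y ∈ Set.Ioo (0 : ℝ) 1, 0 ≤ y ^ α * (1 - y) ^ β * (1 - δ * y) ^ t := by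
    rintro y ⟨hy0, hy1⟩
    have h1 : 0 ≤ 1 - y := by linarith
    have h2 : 0 ≤ 1 - δ * y := by nlinarith
    positivity
  calc ∫ y in Set.Ioo (0 : ℝ) 1, y ^ α * (1 - y) ^ β * (1 - δ * y) ^ t
      ≤ ∫ y in Set.Ioo (0 : ℝ) 1, Real.exp δ *
        ((2 : ℝ) ^ |β| * (y ^ (1 + α - 1) * Real.exp (-(δ * s * y))) +
        Real.exp (-(δ * s / 2)) * (y ^ α * (1 - y) ^ β)) := by
        refine integral_mono_of_nonneg (ae_restrict_of_forall_mem measurableSet_Ioo hnn) ?_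
          (ae_restrict_of_forall_mem measurableSet_Ioo hpt)
        exact ((hgamma'.const_mul _).add (hint.const_mul _)).const_mul _
    _ = Real.exp δ * ((2 : ℝ) ^ |β| *
          (∫ y in Set.Ioo (0 : ℝ) 1, y ^ (1 + α - 1) * Real.exp (-(δ * s * y))) +
        Real.exp (-(δ * s / 2)) * ProbabilityTheory.beta (α + 1) (β + 1)) := by
        rw [integral_const_mul, integral_add (hgamma'.const_mul _) (hint.const_mul _),
          integral_const_mul, integral_const_mul, integral_beta hα hβ]
    _ ≤ Real.exp δ * ((2 : ℝ) ^ |β| * (Real.Gamma (1 + α) / δ ^ (1 + α) / s ^ (1 + α)) +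
        (2 * (1 + α) / δ) ^ (1 + α) / s ^ (1 + α) *
          ProbabilityTheory.beta (α + 1) (β + 1)) := by gcongr
    _ = _ := by
        field_simp

/-- Decay of the spectral integral when the spectrum of `P_lam` stays away from `-1`. -/
theorem exists_integral_abs_pow_le_of_pos {α β lam : ℝ} (hα : -1 < α) (hβ : -1 < β)
    (hlam : 0 < lam) :
    ∃ C : ℝ, ∀ t : ℕ, ∫ x, |(x + lam) / (lam + 1)| ^ t ∂(jacobiMeasure α β) ≤
      C / ((t : ℝ) + 1) ^ (1 + α) := by
  -- `|(x + lam) / (lam + 1)| ≤ 1 - δ y` for `y = (1 - x) / 2`, with equality at `x = 1`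
  set δ : ℝ := min (1 / (lam + 1)) (2 * lam / (lam + 1)) with hδ
  have hδ0 : 0 < δ := lt_min (by positivity) (by positivity)
  have hδ1 : δ ≤ 1 := (min_le_left _ _).trans (by rw [div_le_one (by linarith)]; linarith)
  obtain ⟨C, -, hC⟩ := exists_integral_beta_mul_pow_le hα hβ hδ0 hδ1
  have hb := beta_pos' hα hβ
  refine ⟨1 / ProbabilityTheory.beta (α + 1) (β + 1) * C, fun t => ?_⟩
  rw [integral_jacobiMeasure hα hβ, mul_div_assoc]
  refine mul_le_mul_of_nonneg_left (le_trans ?_ (hC t)) (by positivity)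
  have hint : IntegrableOn (fun y : ℝ => y ^ α * (1 - y) ^ β * (1 - δ * y) ^ t)
      (Set.Ioo 0 1) := by
    refine Integrable.mul_of_top_left (integrableOn_beta hα hβ) ?_
    refine memLp_top_of_bound (by fun_prop) 1 (ae_restrict_of_forall_mem measurableSet_Ioo ?_)
    rintro y ⟨hy0, hy1⟩
    have h2 : 0 ≤ 1 - δ * y := by nlinarith
    rw [Real.norm_of_nonneg (by positivity)]
    exact pow_le_one₀ h2 (by nlinarith)
  refine integral_mono_of_nonneg (ae_restrict_of_forall_mem measurableSet_Ioo ?_) hint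
    (ae_restrict_of_forall_mem measurableSet_Ioo ?_)
  · rintro y ⟨hy0, hy1⟩
    have h1 : 0 ≤ 1 - y := by linarith
    simp only [Pi.zero_apply]
    positivity
  · rintro y ⟨hy0, hy1⟩
    have h1 : 0 ≤ 1 - y := by linarith
    simp only
    refine mul_le_mul_of_nonneg_left (pow_le_pow_left₀ (abs_nonneg _) ?_ t) (by positivity)
    have hA : δ * (lam + 1) ≤ 1 := by
      rw [← le_div_iff₀ (by linarith)]; exact min_le_left _ _
    have hB : δ * (lam + 1) ≤ 2 * lam := by
      rw [← le_div_iff₀ (by linarith)]; exact min_le_right _ _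
    rw [abs_div, abs_of_pos (show 0 < lam + 1 by linarith), div_le_iff₀ (by linarith), abs_le]
    constructor <;> nlinarith

/-- At `lam = 0` the spectrum reaches `-1`, where the weight contributes a decay of order
`t ^ (-1 - β)`; this is no loss as long as `α ≤ β`. -/
theorem exists_integral_abs_pow_le_of_le {α β : ℝ} (hα : -1 < α) (hβ : -1 < β)
    (hαβ : α ≤ β) :
    ∃ C : ℝ, ∀ t : ℕ, ∫ x, |x| ^ t ∂(jacobiMeasure α β) ≤
      C / ((t : ℝ) + 1) ^ (1 + α) := by
  obtain ⟨C₁, -, hC₁⟩ := exists_integral_beta_mul_pow_le hα hβ one_pos le_rfl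
  obtain ⟨C₂, hC₂0, hC₂⟩ := exists_integral_beta_mul_pow_le hβ hα one_pos le_rfl
  have hb := beta_pos' hα hβ
  refine ⟨1 / ProbabilityTheory.beta (α + 1) (β + 1) * (C₁ + C₂), fun t => ?_⟩
  have hbound : ∀ f : ℝ → ℝ, Measurable f → (∀ y ∈ Set.Ioo (0 : ℝ) 1, |f y| ≤ 1) →
      IntegrableOn (fun y : ℝ => y ^ α * (1 - y) ^ β * f y) (Set.Ioo 0 1) := fun f hf hf1 =>
    Integrable.mul_of_top_left (integrableOn_beta hα hβ)
      (memLp_top_of_bound hf.aestronglyMeasurable 1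
        (ae_restrict_of_forall_mem measurableSet_Ioo hf1))
  have hint₁ := hbound (fun y => (1 - 1 * y) ^ t) (by fun_prop) fun y hy => by
    have : 0 ≤ 1 - 1 * y := by linarith [hy.2]
    rw [abs_of_nonneg (by positivity)]
    exact pow_le_one₀ this (by linarith [hy.1])
  have hint₂ := hbound (fun y => y ^ t) (by fun_prop) fun y hy => by
    have := hy.1.le
    rw [abs_of_nonneg (by positivity)]
    exact pow_le_one₀ this hy.2.le
  have hrefl : ∫ y in Set.Ioo (0 : ℝ) 1, y ^ α * (1 - y) ^ β * y ^ t =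
      ∫ y in Set.Ioo (0 : ℝ) 1, y ^ β * (1 - y) ^ α * (1 - 1 * y) ^ t := by
    have h := intervalIntegral.integral_comp_sub_left
      (fun y : ℝ => y ^ α * (1 - y) ^ β * y ^ t) (a := 0) (b := 1) 1
    rw [sub_self, sub_zero, intervalIntegral.integral_of_le zero_le_one,
      intervalIntegral.integral_of_le zero_le_one, integral_Ioc_eq_integral_Ioo,
      integral_Ioc_eq_integral_Ioo] at h
    rw [← h]
    congr 1
    ext y
    rw [sub_sub_cancel, one_mul]
    ring
  rw [integral_jacobiMeasure hα hβ, mul_div_assoc]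
  refine mul_le_mul_of_nonneg_left ?_ (by positivity)
  have hmono : C₂ / ((t : ℝ) + 1) ^ (1 + β) ≤ C₂ / ((t : ℝ) + 1) ^ (1 + α) := by
    have : ((t : ℝ) + 1) ^ (1 + α) ≤ ((t : ℝ) + 1) ^ (1 + β) :=
      Real.rpow_le_rpow_of_exponent_le (by linarith [t.cast_nonneg (α := ℝ)]) (by linarith)
    gcongr
  rw [add_div]
  refine le_trans ?_ (add_le_add (hC₁ t) ((hC₂ t).trans hmono))
  rw [← hrefl, ← integral_add hint₁ hint₂]
  refine integral_mono_of_nonneg (ae_restrict_of_forall_mem measurableSet_Ioo ?_)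
    (hint₁.add hint₂) (ae_restrict_of_forall_mem measurableSet_Ioo ?_)
  · rintro y ⟨hy0, hy1⟩
    have h1 : 0 ≤ 1 - y := by linarith
    simp only [Pi.zero_apply]
    positivity
  · rintro y ⟨hy0, hy1⟩
    have h1 : 0 ≤ 1 - y := by linarith
    simp only
    rw [← mul_add]
    refine mul_le_mul_of_nonneg_left ?_ (by positivity)
    have h2 : (0 : ℝ) ≤ (1 - 1 * y) ^ t := by rw [one_mul]; positivity
    have h3 : (0 : ℝ) ≤ y ^ t := by positivity
    rcases le_total y (1 / 2) with hy | hy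
    · have : |1 - 2 * y| ^ t ≤ (1 - 1 * y) ^ t :=
        pow_le_pow_left₀ (abs_nonneg _) (by rw [abs_le]; constructor <;> linarith) t
      linarith
    · have : |1 - 2 * y| ^ t ≤ y ^ t :=
        pow_le_pow_left₀ (abs_nonneg _) (by rw [abs_le]; constructor <;> linarith) t
      linarith

/-! ### Total mass of the reversibility function -/

section

variable {α β N : ℝ}

theorem revMeasure_pos (hα : -1 < α) (hβ : -1 < β) (hN : 0 < N)
    (hq : ∀ n, 1 ≤ n → 0 < q α β N n) (n : ℕ) : 0 < revMeasure α β N n := by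
  rw [revMeasure_eq hα hβ hN hq]
  exact one_div_pos.2 (normSqQ_pos hα hβ hN n)

/-- The kernel polynomial `∑ π_k Q_k` has the same value at `1` and squared norm, so the atom at `1`
bounds this value. -/
theorem sum_revMeasure_le (hα : -1 < α) (hβ : -1 < β) (hN : 0 < N)
    (hq : ∀ n, 1 ≤ n → 0 < q α β N n) (n : ℕ) :
    ∑ k ∈ Finset.range n, revMeasure α β N k ≤ (N + 1) / N := by
  have h := le_psiInner_self hα hβ hN
    (∑ k ∈ Finset.range n, C (revMeasure α β N k) * Q α β N k)
  rw [psiInner_sum_Q_self hα hβ hN] at h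
  simp only [eval_finsetSum, eval_mul, eval_C, eval_one_Q hα hβ, mul_one] at h
  have hsq : ∀ k, revMeasure α β N k ^ 2 * normSqQ α β N k = revMeasure α β N k := fun k => by
    rw [revMeasure_eq hα hβ hN hq]
    have := (normSqQ_pos hα hβ hN k).ne'
    field_simp
  simp only [hsq] at h
  have h0 : 0 ≤ ∑ k ∈ Finset.range n, revMeasure α β N k :=
    Finset.sum_nonneg fun k _ => (revMeasure_pos hα hβ hN hq k).le
  rcases h0.eq_or_lt with h1 | h1
  · rw [← h1]
    positivity
  · rw [sq, ← mul_assoc] at h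
    have h2 := le_of_mul_le_mul_right (h.trans_eq (one_mul _).symm) h1
    rwa [le_div_iff₀ hN, mul_comm, ← div_le_one (by positivity), mul_div_right_comm]

theorem summable_revMeasure (hα : -1 < α) (hβ : -1 < β) (hN : 0 < N)
    (hq : ∀ n, 1 ≤ n → 0 < q α β N n) : Summable (revMeasure α β N) :=
  summable_of_sum_range_le (fun n => (revMeasure_pos hα hβ hN hq n).le)
    (sum_revMeasure_le hα hβ hN hq)

theorem one_le_psiInner_mul_tsum (hα : -1 < α) (hβ : -1 < β) (hN : 0 < N)
    (hq : ∀ n, 1 ≤ n → 0 < q α β N n) {f : ℝ[X]} (hf : f.eval 1 = 1) :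
    1 ≤ psiInner α β N f f * ∑' k, revMeasure α β N k := by
  obtain ⟨a, ha⟩ := exists_eq_sum_Q hα hβ hN f.natDegree f (Nat.lt_succ_self _)
  have h1 : ∑ k ∈ Finset.range (f.natDegree + 1), a k = 1 := by
    have h := congrArg (eval 1) ha
    simp only [eval_finsetSum, eval_mul, eval_C, eval_one_Q hα hβ, mul_one, hf] at h
    exact h.symm
  have h2 : psiInner α β N f f =
      ∑ k ∈ Finset.range (f.natDegree + 1), a k ^ 2 * normSqQ α β N k := by
    rw [← psiInner_sum_Q_self hα hβ hN, ← ha]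
  have h3 := Finset.sum_sq_le_sum_mul_sum_of_sq_le_mul (Finset.range (f.natDegree + 1))
    (r := a) (f := fun k => a k ^ 2 * normSqQ α β N k) (g := revMeasure α β N)
    (fun k _ => mul_nonneg (sq_nonneg _) (normSqQ_pos hα hβ hN k).le)
    (fun k _ => (revMeasure_pos hα hβ hN hq k).le)
    (fun k _ => by
      rw [revMeasure_eq hα hβ hN hq, mul_one_div,
        mul_div_cancel_right₀ _ (normSqQ_pos hα hβ hN k).ne'])
  rw [h1, one_pow, ← h2] at h3
  refine h3.trans (mul_le_mul_of_nonneg_left ?_ ?_)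
  · exact (summable_revMeasure hα hβ hN hq).sum_le_tsum _
      fun k _ => (revMeasure_pos hα hβ hN hq k).le
  · exact integral_nonneg fun x => mul_self_nonneg _

/-- The total mass of `π` is the reciprocal of the atom of `psi` at `1`; the lower bound uses the
test polynomials `((1 + x) / 2) ^ m`. -/
theorem tsum_revMeasure (hα : -1 < α) (hβ : -1 < β) (hN : 0 < N)
    (hq : ∀ n, 1 ≤ n → 0 < q α β N n) : ∑' k, revMeasure α β N k = (N + 1) / N := by
  refine le_antisymm (Real.tsum_le_of_sum_range_le
    (fun n => (revMeasure_pos hα hβ hN hq n).le) (sum_revMeasure_le hα hβ hN hq)) ?_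
  obtain ⟨C₀, hC⟩ := exists_integral_abs_pow_le_of_pos hα hβ one_pos
  have hρ : 0 ≤ ∑' k, revMeasure α β N k :=
    tsum_nonneg fun k => (revMeasure_pos hα hβ hN hq k).le
  have key : ∀ m : ℕ, 1 ≤ 1 / (N + 1) * (C₀ / (((2 * m : ℕ) : ℝ) + 1) ^ (1 + α) + N) *
      ∑' k, revMeasure α β N k := by
    intro m
    refine (one_le_psiInner_mul_tsum hα hβ hN hq
      (f := (C (1 / 2) * (X + 1)) ^ m) (by norm_num)).trans ?_
    refine mul_le_mul_of_nonneg_right ?_ hρ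
    rw [psiInner_eq hα hβ hN]
    simp only [eval_pow, eval_mul, eval_C, eval_add, eval_X, eval_one]
    refine mul_le_mul_of_nonneg_left (add_le_add ?_ ?_) (by positivity)
    · refine le_trans (le_of_eq ?_) (hC (2 * m))
      refine integral_congr_ae (Filter.Eventually.of_forall fun x => ?_)
      simp only
      rw [pow_mul, sq_abs, ← pow_mul, ← pow_add, ← two_mul]
      congr 1
      ring
    · norm_num
  have hlim : Filter.Tendsto (fun m : ℕ => 1 / (N + 1) *
      (C₀ / (((2 * m : ℕ) : ℝ) + 1) ^ (1 + α) + N) * ∑' k, revMeasure α β N k) Filter.atTop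
      (nhds (1 / (N + 1) * (0 + N) * ∑' k, revMeasure α β N k)) := by
    refine Filter.Tendsto.mul_const _ (Filter.Tendsto.const_mul _
      (Filter.Tendsto.add_const _ (Filter.Tendsto.const_div_atTop ?_ _)))
    refine (tendsto_rpow_atTop (by linarith)).comp (Filter.tendsto_atTop_add_const_right _ _ ?_)
    exact tendsto_natCast_atTop_atTop.comp
      (Filter.tendsto_id.const_mul_atTop' (by norm_num : 0 < 2))
  have h := ge_of_tendsto' hlim key
  rw [div_le_iff₀ hN]
  have h2 := mul_le_mul_of_nonneg_left h (show 0 ≤ N + 1 by linarith)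
  calc N + 1 = (N + 1) * 1 := (mul_one _).symm
    _ ≤ _ := h2
    _ = _ := by field_simp; ring

theorem stationary_eq (hα : -1 < α) (hβ : -1 < β) (hN : 0 < N)
    (hq : ∀ n, 1 ≤ n → 0 < q α β N n) (n : ℕ) :
    stationary α β N n = revMeasure α β N n * (N / (N + 1)) := by
  rw [stationary, tsum_revMeasure hα hβ hN hq, div_eq_mul_inv, inv_div]

/-! ### The birth and death chain -/

theorem transition_eq_zero (lam : ℝ) {i k : ℕ} (h : k + 1 < i) : transition α β N lam i k = 0 := by
  have h1 : ¬ k = i + 1 := by omega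
  have h2 : ¬ k = i := by omega
  have h3 : ¬ k + 1 = i := by omega
  have h4 : ¬ i = k := by omega
  simp [transition, H, h1, h2, h3, h4]

theorem sum_transition_mul (lam : ℝ) (n : ℕ) (g : ℕ → ℝ) :
    ∑ i ∈ Finset.range (n + 2), transition α β N lam n i * g i =
      1 / (lam + 1) * (p α β N n * g (n + 1) + r α β N n * g n + q α β N n * g (n - 1) +
        lam * g n) := by
  rw [Finset.sum_range_succ, Finset.sum_range_succ]
  have h0 : transition α β N lam n (n + 1) = 1 / (lam + 1) * p α β N n := by
    simp [transition, H]
  have h1 : transition α β N lam n n = 1 / (lam + 1) * (r α β N n + lam) := by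
    simp [transition, H]
  rw [h0, h1]
  rcases n with - | n
  · simp [q]
    ring
  · have h2 : transition α β N lam (n + 1) n = 1 / (lam + 1) * q α β N (n + 1) := by
      have h3 : ¬ n = n + 1 + 1 := by omega
      simp [transition, H, h3]
    rw [Finset.sum_range_succ, h2, Finset.sum_eq_zero]
    · rw [Nat.add_sub_cancel]
      ring
    · intro k hk
      have hk := Finset.mem_range.1 hk
      have h3 : ¬ k = n + 1 + 1 := by omega
      have h4 : ¬ k = n + 1 := by omega
      have h5 : ¬ k + 1 = n + 1 := by omega
      have h6 : ¬ n + 1 = k := by omega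
      simp [transition, H, h3, h4, hk.ne, h6]

theorem revMeasure_mul_p (hq : ∀ n, 1 ≤ n → 0 < q α β N n) (n : ℕ) :
    revMeasure α β N n * p α β N n = revMeasure α β N (n + 1) * q α β N (n + 1) := by
  have h3 := (hq (n + 1) (by omega)).ne'
  rw [revMeasure, revMeasure, Finset.prod_range_succ, Finset.prod_range_succ,
    mul_div_mul_comm]
  field_simp

/-- Detailed balance. -/
theorem revMeasure_mul_transition (hq : ∀ n, 1 ≤ n → 0 < q α β N n) (lam : ℝ) (i k : ℕ) :
    revMeasure α β N i * transition α β N lam i k =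
      revMeasure α β N k * transition α β N lam k i := by
  have hstep : ∀ n, revMeasure α β N n * transition α β N lam n (n + 1) =
      revMeasure α β N (n + 1) * transition α β N lam (n + 1) n := by
    intro n
    have h3 : ¬ n = n + 1 + 1 := by omega
    simp only [transition, H]
    simp [h3]
    linear_combination (lam + 1)⁻¹ * revMeasure_mul_p hq n
  rcases lt_trichotomy i k with h | rfl | h
  · rcases (Nat.succ_le_of_lt h).eq_or_lt with rfl | h'
    · exact hstep i
    · have h1 : ¬ k = i + 1 := by omega
      have h2 : ¬ k = i := by omega
      have h3 : ¬ k + 1 = i := by omega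
      have h4 : ¬ i = k := by omega
      rw [transition_eq_zero lam h', mul_zero]
      simp [transition, H, h1, h2, h3, h4]
  · rfl
  · rcases (Nat.succ_le_of_lt h).eq_or_lt with rfl | h'
    · exact (hstep k).symm
    · have h1 : ¬ i = k + 1 := by omega
      have h2 : ¬ i = k := by omega
      have h3 : ¬ i + 1 = k := by omega
      have h4 : ¬ k = i := by omega
      rw [transition_eq_zero lam h', mul_zero]
      simp [transition, H, h1, h2, h3, h4]

theorem hasSum_mul_transition (lam : ℝ) (ν : ℕ → ℝ) (k : ℕ) :
    HasSum (fun i => ν i * transition α β N lam i k)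
      (∑ i ∈ Finset.range (k + 2), ν i * transition α β N lam i k) := by
  refine hasSum_sum_of_ne_finset_zero fun i hi => ?_
  rw [transition_eq_zero lam (by have := Finset.mem_range.not.1 hi; omega), mul_zero]

/-- Detailed balance turns the action of `P_lam` on measures with a density `g` with respect to `π`
into its action on functions. -/
theorem sum_density_mul_transition (hq : ∀ n, 1 ≤ n → 0 < q α β N n) (lam : ℝ) (g : ℕ → ℝ)
    (k : ℕ) :
    ∑ i ∈ Finset.range (k + 2), revMeasure α β N i * g i * transition α β N lam i k =
      revMeasure α β N k * ∑ i ∈ Finset.range (k + 2), transition α β N lam k i * g i := by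
  rw [Finset.mul_sum]
  refine Finset.sum_congr rfl fun i _ => ?_
  linear_combination g i * revMeasure_mul_transition hq lam i k

/-- The density of a stationary measure with respect to `π` is harmonic; a harmonic function of a
birth and death chain without killing is constant. -/
theorem isStationaryDistribution_iff (hα : -1 < α) (hβ : -1 < β) (hN : 0 < N)
    (hp : ∀ n, 0 < p α β N n) (hq : ∀ n, 1 ≤ n → 0 < q α β N n) {lam : ℝ} (hlam : 0 ≤ lam)
    (ν : ℕ → ℝ) :
    IsStationaryDistribution (transition α β N lam) ν ↔ ν = stationary α β N := by
  have hπ := revMeasure_pos hα hβ hN hq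
  have hsum := (summable_revMeasure hα hβ hN hq).hasSum
  have hρ : 0 < ∑' k, revMeasure α β N k := by
    rw [tsum_revMeasure hα hβ hN hq]
    positivity
  constructor
  · rintro ⟨-, hν1, hν⟩
    set g : ℕ → ℝ := fun n => ν n / revMeasure α β N n with hg
    have hνg : ∀ n, ν n = revMeasure α β N n * g n := fun n => by
      rw [hg]
      have := (hπ n).ne'
      field_simp
    have hharm : ∀ k, p α β N k * g (k + 1) + r α β N k * g k + q α β N k * g (k - 1) =
        g k := by
      intro k
      have h := (hν k).unique (hasSum_mul_transition lam ν k)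
      simp only [hνg] at h
      rw [sum_density_mul_transition hq, sum_transition_mul] at h
      have h2 := mul_left_cancel₀ (hπ k).ne' h
      field_simp at h2
      linarith
    have hstep : ∀ k, g (k + 1) = g k := by
      intro k
      have h1 := p_add_r_add_q hα hβ hN k
      have h2 := hharm k
      have h3 : q α β N k * g (k - 1) = q α β N k * g k := by
        induction k with
        | zero => simp [q]
        | succ k ih =>
          have h3 := ih (p_add_r_add_q hα hβ hN k) (hharm k)
          have h4 : g (k + 1) = g k := by
            refine mul_left_cancel₀ (hp k).ne' ?_
            linear_combination hharm k - h3 - g k * p_add_r_add_q hα hβ hN k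
          rw [Nat.add_sub_cancel, h4]
      refine mul_left_cancel₀ (hp k).ne' ?_
      linear_combination h2 - h3 - g k * h1
    have hconst : ∀ k, g k = g 0 := fun k => by
      induction k with
      | zero => rfl
      | succ k ih => rw [hstep, ih]
    have hν' : ν = fun n => revMeasure α β N n * g 0 := by
      ext n
      rw [hνg, hconst]
    have hg0 : (∑' k, revMeasure α β N k) * g 0 = 1 := by
      rw [hν'] at hν1
      exact (hsum.mul_right (g 0)).unique hν1
    ext n
    rw [hν', stationary, eq_div_iff hρ.ne', mul_assoc, mul_comm (g 0), hg0, mul_one]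
  · rintro rfl
    refine ⟨fun n => div_nonneg (hπ n).le hρ.le, ?_, fun k => ?_⟩
    · have := hsum.div_const (∑' k, revMeasure α β N k)
      rwa [div_self hρ.ne'] at this
    · have h := hasSum_mul_transition (α := α) (β := β) (N := N) lam (stationary α β N) k
      have h2 := sum_density_mul_transition hq lam
        (fun _ => 1 / ∑' k, revMeasure α β N k) k
      rw [sum_transition_mul] at h2
      simp only [mul_one_div] at h2
      rw [show stationary α β N = fun n => revMeasure α β N n / ∑' k, revMeasure α β N k from rfl]
        at h ⊢
      rw [h2] at h
      convert h using 1
      have h1 := p_add_r_add_q hα hβ hN k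
      field_simp
      linear_combination -revMeasure α β N k * h1

/-- Multiplication by this polynomial represents `P_lam` in the basis `Q_n`. -/
def transitionSymbol (lam : ℝ) : ℝ[X] := C (1 / (lam + 1)) * (X + C lam)

theorem psiInner_transitionSymbol_mul_Q (hα : -1 < α) (hβ : -1 < β) (hN : 0 < N) (lam : ℝ)
    (f : ℝ[X]) (n : ℕ) :
    psiInner α β N f (transitionSymbol lam * Q α β N n) =
      ∑ i ∈ Finset.range (n + 2), transition α β N lam n i * psiInner α β N f (Q α β N i) := by
  have hadd : ∀ g h : ℝ[X], psiInner α β N f (g + h) =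
      psiInner α β N f g + psiInner α β N f h := by
    intro g h
    simp only [psiInner, eval_add, mul_add]
    exact integral_add (integrable_psi hα hβ N (by fun_prop)) (integrable_psi hα hβ N (by fun_prop))
  rw [sum_transition_mul, transitionSymbol, mul_assoc, psiInner_C_mul_right, add_mul,
    X_mul_Q hα hβ hN, hadd, hadd, hadd, psiInner_C_mul_right, psiInner_C_mul_right,
    psiInner_C_mul_right, psiInner_C_mul_right]

/-- The Karlin–McGregor representation of the law of the chain. -/
theorem law_eq (hα : -1 < α) (hβ : -1 < β) (hN : 0 < N)
    (hq : ∀ n, 1 ≤ n → 0 < q α β N n) (lam : ℝ) (j t n : ℕ) :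
    law α β N lam j t n = revMeasure α β N n *
      psiInner α β N (transitionSymbol lam ^ t * Q α β N j) (Q α β N n) := by
  induction t generalizing n with
  | zero =>
    rw [law, pow_zero, one_mul]
    split_ifs with h
    · rw [h, revMeasure_eq hα hβ hN hq, ← normSqQ, one_div_mul_cancel (normSqQ_pos hα hβ hN j).ne']
    · rw [psiInner_Q_Q_of_ne hα hβ hN (Ne.symm h), mul_zero]
  | succ t ih =>
    rw [law, (hasSum_mul_transition lam _ n).tsum_eq]
    simp only [ih]
    rw [sum_density_mul_transition hq, ← psiInner_transitionSymbol_mul_Q hα hβ hN,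
      ← psiInner_mul_left, ← mul_assoc, ← pow_succ']

theorem law_eq_zero (hα : -1 < α) (hβ : -1 < β) (hN : 0 < N)
    (hq : ∀ n, 1 ≤ n → 0 < q α β N n) (lam : ℝ) {j t n : ℕ} (h : t + j < n) :
    law α β N lam j t n = 0 := by
  rw [law_eq hα hβ hN hq, psiInner_Q_eq_zero hα hβ hN, mul_zero]
  have h1 : (transitionSymbol lam).natDegree ≤ 1 :=
    (natDegree_C_mul_le _ _).trans (natDegree_X_add_C _).le
  have h2 := natDegree_mul_le_of_le (natDegree_pow_le_of_le t h1) (natDegree_Q_le α β N j)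
  omega

theorem abs_eval_le_supNorm (f : ℝ[X]) {x : ℝ} (hx : x ∈ Set.Icc (-1 : ℝ) 1) :
    |f.eval x| ≤ supNorm f := by
  have hb : BddAbove (Set.range fun x : Set.Icc (-1 : ℝ) 1 => |f.eval (x : ℝ)|) := by
    obtain ⟨M, hM⟩ := (isCompact_Icc (a := (-1 : ℝ)) (b := 1)).exists_bound_of_continuousOn
      f.continuous.continuousOn
    exact ⟨M, by rintro _ ⟨y, rfl⟩; exact hM y y.2⟩
  exact le_ciSup hb ⟨x, hx⟩

theorem supNorm_nonneg (f : ℝ[X]) : 0 ≤ supNorm f :=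
  (abs_nonneg _).trans (abs_eval_le_supNorm f (x := 0) (by constructor <;> norm_num))

/-- The atom of `psi` at `1` produces exactly `ν` in the Karlin–McGregor formula; what is left is an
integral against the Jacobi weight. -/
theorem abs_stationary_sub_law_le (hα : -1 < α) (hβ : -1 < β) (hN : 0 < N)
    (hq : ∀ n, 1 ≤ n → 0 < q α β N n) {lam : ℝ} (hlam : 0 ≤ lam) (j t n : ℕ) :
    |stationary α β N n - law α β N lam j t n| ≤ supNorm (Q α β N j) *
      (∫ x, |(x + lam) / (lam + 1)| ^ t ∂(jacobiMeasure α β)) *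
        (revMeasure α β N n * supNorm (Q α β N n)) := by
  have hπ := revMeasure_pos hα hβ hN hq n
  have hT : ∀ x : ℝ, (transitionSymbol lam).eval x = (x + lam) / (lam + 1) := by
    intro x
    simp [transitionSymbol]
    ring
  have hI : stationary α β N n - law α β N lam j t n = -(revMeasure α β N n * (1 / (N + 1)) *
      ∫ x, ((x + lam) / (lam + 1)) ^ t * (Q α β N j).eval x * (Q α β N n).eval x
        ∂(jacobiMeasure α β)) := by
    rw [stationary_eq hα hβ hN hq, law_eq hα hβ hN hq, psiInner_eq hα hβ hN]
    simp only [eval_mul, eval_pow, hT, eval_one_Q hα hβ]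
    rw [add_comm 1 lam, div_self (by linarith), one_pow]
    ring
  have hbound : |∫ x, ((x + lam) / (lam + 1)) ^ t * (Q α β N j).eval x * (Q α β N n).eval x
        ∂(jacobiMeasure α β)| ≤
      ∫ x, |(x + lam) / (lam + 1)| ^ t * (supNorm (Q α β N j) * supNorm (Q α β N n))
        ∂(jacobiMeasure α β) := by
    refine (abs_integral_le_integral_abs).trans ?_
    have h0 : lam + 1 ≠ 0 := by linarith
    refine integral_mono_ae (integrable_jacobiMeasure hα hβ (by fun_prop))
      (integrable_jacobiMeasure hα hβ (by fun_prop)) ?_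
    filter_upwards [ae_jacobiMeasure_mem α β] with x hx
    have hx' := Set.Ioo_subset_Icc_self hx
    rw [abs_mul, abs_mul, abs_pow, mul_assoc]
    refine mul_le_mul_of_nonneg_left (mul_le_mul (abs_eval_le_supNorm _ hx')
      (abs_eval_le_supNorm _ hx') (abs_nonneg _) (supNorm_nonneg _)) (by positivity)
  rw [integral_mul_const] at hbound
  have hN1 : 1 / (N + 1) ≤ 1 := by rw [div_le_one (by linarith)]; linarith
  rw [hI, abs_neg, abs_mul, abs_of_pos (by positivity)]
  calc _ ≤ revMeasure α β N n * 1 * _ :=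
        mul_le_mul (mul_le_mul_of_nonneg_left hN1 hπ.le) hbound (abs_nonneg _) (by positivity)
    _ = _ := by ring

theorem stationary_le_revMeasure (hα : -1 < α) (hβ : -1 < β) (hN : 0 < N)
    (hq : ∀ n, 1 ≤ n → 0 < q α β N n) (n : ℕ) : stationary α β N n ≤ revMeasure α β N n := by
  rw [stationary_eq hα hβ hN hq]
  refine mul_le_of_le_one_right (revMeasure_pos hα hβ hN hq n).le ?_
  rw [div_le_one (by linarith)]
  linarith

theorem tvDist_le (hα : -1 < α) (hβ : -1 < β) (hN : 0 < N)
    (hq : ∀ n, 1 ≤ n → 0 < q α β N n) {lam : ℝ} (hlam : 0 ≤ lam) {K : ℝ} (j t : ℕ)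
    (hK : ∫ x, |(x + lam) / (lam + 1)| ^ t ∂(jacobiMeasure α β) ≤
      K / ((t : ℝ) + 1) ^ (1 + α)) :
    tvDist (stationary α β N) (law α β N lam j t) ≤
      K * supNorm (Q α β N j) / ((t : ℝ) + 1) ^ (1 + α) *
        (∑ n ∈ Finset.range (t + j + 1), revMeasure α β N n * supNorm (Q α β N n)) +
      1 / 2 * ∑' n : ℕ, revMeasure α β N (n + (j + t + 1)) := by
  have hsπ := summable_revMeasure hα hβ hN hq
  have htail : ∀ n, |stationary α β N (n + (j + t + 1)) -
      law α β N lam j t (n + (j + t + 1))| = stationary α β N (n + (j + t + 1)) := by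
    intro n
    rw [law_eq_zero hα hβ hN hq lam (by omega), sub_zero, abs_of_nonneg]
    rw [stationary_eq hα hβ hN hq]
    have := revMeasure_pos hα hβ hN hq (n + (j + t + 1))
    positivity
  have hsν : Summable (stationary α β N) := by
    rw [funext (stationary_eq hα hβ hN hq)]
    exact hsπ.mul_right _
  have hs : Summable fun n => |stationary α β N n - law α β N lam j t n| := by
    rw [← summable_nat_add_iff (j + t + 1)]
    simp only [htail]
    exact (summable_nat_add_iff (j + t + 1)).2 hsν
  have h1 : ∑ n ∈ Finset.range (j + t + 1), |stationary α β N n - law α β N lam j t n| ≤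
      K * supNorm (Q α β N j) / ((t : ℝ) + 1) ^ (1 + α) *
        ∑ n ∈ Finset.range (j + t + 1), revMeasure α β N n * supNorm (Q α β N n) := by
    rw [Finset.mul_sum]
    refine Finset.sum_le_sum fun n _ => ?_
    refine (abs_stationary_sub_law_le hα hβ hN hq hlam j t n).trans ?_
    refine mul_le_mul_of_nonneg_right ?_
      (mul_nonneg (revMeasure_pos hα hβ hN hq n).le (supNorm_nonneg _))
    calc _ ≤ supNorm (Q α β N j) * (K / ((t : ℝ) + 1) ^ (1 + α)) :=
          mul_le_mul_of_nonneg_left hK (supNorm_nonneg _)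
      _ = _ := by ring
  have h0 : 0 ≤ ∑ n ∈ Finset.range (j + t + 1),
      |stationary α β N n - law α β N lam j t n| := Finset.sum_nonneg fun _ _ => abs_nonneg _
  have h2 : ∑' n : ℕ, stationary α β N (n + (j + t + 1)) ≤
      ∑' n : ℕ, revMeasure α β N (n + (j + t + 1)) :=
    Summable.tsum_le_tsum (fun n => stationary_le_revMeasure hα hβ hN hq _)
      ((summable_nat_add_iff _).2 hsν) ((summable_nat_add_iff _).2 hsπ)
  rw [tvDist, ← hs.sum_add_tsum_nat_add (j + t + 1), add_comm t j]
  simp only [htail]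
  linarith

end

/-! ### The admissible values of `lam` -/

section

variable {α β N : ℝ}

theorem coeff_jacobi_comp (α β : ℝ) (n k : ℕ) : ((jacobi α β n).comp (1 - C 2 * X)).coeff k =
    poch (α + 1) n / (n.factorial : ℝ) * jacobiCoeff α β n k := by
  have hY : (C (1 / 2) * (1 - (1 - C 2 * X)) : ℝ[X]) = X := by
    rw [sub_sub_cancel, ← mul_assoc, ← C_mul]
    norm_num
  have h : (jacobi α β n).comp (1 - C 2 * X) = C (poch (α + 1) n / (n.factorial : ℝ)) *
      ∑ k ∈ Finset.range (n + 1), C (jacobiCoeff α β n k) * X ^ k := by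
    rw [jacobi_eq]
    simp only [mul_comp, C_comp, Polynomial.sum_comp, pow_comp, sub_comp, one_comp, X_comp]
    rw [hY]
  rw [h, coeff_C_mul, finsetSum_coeff]
  simp only [coeff_C_mul_X_pow]
  rw [Finset.sum_ite_eq (Finset.range (n + 1)) k]
  split_ifs with hk
  · rfl
  · rw [jacobiCoeff, Nat.choose_eq_zero_of_lt (by have := Finset.mem_range.not.1 hk; omega)]
    simp

/-- The coefficients of `Q_n` as a polynomial in `(1 - x) / 2`. -/
theorem coeff_Q_comp (α β N : ℝ) (n k : ℕ) : ((Q α β N n).comp (1 - C 2 * X)).coeff k =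
    poch (α + β + 2) (n - 1) / (n.factorial : ℝ) * coeffA α β n *
      (N * (((k : ℝ) + 1) * jacobiCoeff α β n (k + 1) - k * jacobiCoeff α β n k) +
        coeffB α β N n * jacobiCoeff α β n k) *
      ((n.factorial : ℝ) / poch (α + 1) n * (poch (α + 1) n / (n.factorial : ℝ))) := by
  have hd : ((1 + X) * derivative (jacobi α β n)).comp (1 - C 2 * X) =
      (X - 1) * derivative ((jacobi α β n).comp (1 - C 2 * X)) := by
    rw [derivative_comp, mul_comp]
    simp only [derivative_sub, derivative_one, derivative_C_mul, derivative_X, add_comp, one_comp,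
      X_comp, mul_one, zero_sub]
    have : (C 2 : ℝ[X]) = 2 := rfl
    rw [this]
    ring
  have hXd : ∀ f : ℝ[X], (X * derivative f).coeff k = k * f.coeff k := by
    intro f
    rcases k with - | k
    · simp
    · rw [coeff_X_mul, coeff_derivative]
      push_cast
      ring
  have h : (Q α β N n).comp (1 - C 2 * X) = C ((n.factorial : ℝ) / poch (α + 1) n) *
      (C (poch (α + β + 2) (n - 1) / (n.factorial : ℝ) * coeffA α β n) *
        (C N * (derivative ((jacobi α β n).comp (1 - C 2 * X)) -
          X * derivative ((jacobi α β n).comp (1 - C 2 * X))) +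
        C (coeffB α β N n) * (jacobi α β n).comp (1 - C 2 * X))) := by
    rw [Q, koornwinder]
    simp only [mul_comp (C _), add_comp, C_comp]
    rw [neg_mul, neg_mul, neg_comp, mul_assoc, mul_comp (C N), C_comp, hd]
    ring
  rw [h, coeff_C_mul, coeff_C_mul, coeff_add, coeff_C_mul, coeff_sub, coeff_C_mul, hXd,
    coeff_derivative, coeff_jacobi_comp, coeff_jacobi_comp]
  ring

/-- The quotient of the two leading coefficients of `Q_n`, as a polynomial in `(1 - x) / 2`. -/
def leadingRatio (α β N : ℝ) : ℕ → ℝ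
  | 0 => 0
  | n + 1 => ((Q α β N (n + 1)).comp (1 - C 2 * X)).coeff n /
      ((Q α β N (n + 1)).comp (1 - C 2 * X)).coeff (n + 1)

theorem coeff_Q_comp_eq_zero {n k : ℕ} (h : n < k) :
    ((Q α β N n).comp (1 - C 2 * X)).coeff k = 0 := by
  rw [coeff_Q_comp, jacobiCoeff, jacobiCoeff, Nat.choose_eq_zero_of_lt h,
    Nat.choose_eq_zero_of_lt (by omega)]
  simp

theorem le_coeffB_sub (hα : -1 < α) (hβ : -1 < β) (n : ℕ) :
    N * n * (n + β) < (α + 1) * (coeffB α β N n - N * n) := by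
  have ha : 0 < α + 1 := by linarith
  have h1 := poch_pos ha n
  have h2 := poch_pos (show 0 < β + 1 by linarith) n
  have h3 := poch_pos (show 0 < α + β + 2 by linarith) (n - 1)
  have h4 : 0 < (n.factorial : ℝ) := by exact_mod_cast Nat.factorial_pos n
  have h : 0 < (α + 1) * (poch (β + 1) n * (n.factorial : ℝ) /
      (poch (α + 1) n * poch (α + β + 2) (n - 1))) := by positivity
  have h5 : (α + 1) * ((n : ℝ) * ((n : ℝ) + α + β + 1) * N / (α + 1)) =
      n * (n + α + β + 1) * N := by field_simp
  rw [coeffB, mul_sub (α + 1), mul_add (α + 1), h5]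
  linarith

theorem coeffB_sub_pos (hα : -1 < α) (hβ : -1 < β) (hN : 0 < N) (n : ℕ) :
    0 < coeffB α β N n - N * n := by
  have ha : 0 < α + 1 := by linarith
  refine pos_of_mul_pos_right (a := α + 1) (lt_of_le_of_lt ?_ (le_coeffB_sub hα hβ n)) ha.le
  rcases n with - | n
  · simp
  · have : 0 < ((n + 1 : ℕ) : ℝ) + β := by push_cast; linarith [n.cast_nonneg (α := ℝ)]
    positivity

theorem coeff_Q_comp_self_ne_zero (hα : -1 < α) (hβ : -1 < β) (hN : 0 < N) (n : ℕ) :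
    ((Q α β N n).comp (1 - C 2 * X)).coeff n ≠ 0 := by
  have hpos : ∀ m : ℕ, 0 < poch ((m : ℝ) + α + β + 1) m := by
    intro m
    rcases m with - | m
    · simp
    · exact poch_pos (by push_cast; linarith [m.cast_nonneg (α := ℝ)]) _
  have h0 := coeffB_sub_pos hα hβ hN n
  have h1 := poch_pos (show 0 < α + 1 by linarith) n
  have h2 := poch_pos (show 0 < β + 1 by linarith) n
  have h3 := poch_pos (show 0 < α + β + 2 by linarith) (n - 1)
  have h4 := hpos n
  have h5 : 0 < (n.factorial : ℝ) := by exact_mod_cast Nat.factorial_pos n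
  have h6 : N * (((n : ℝ) + 1) * jacobiCoeff α β n (n + 1) - n * jacobiCoeff α β n n) +
      coeffB α β N n * jacobiCoeff α β n n =
      (coeffB α β N n - N * n) * jacobiCoeff α β n n := by
    rw [jacobiCoeff, Nat.choose_succ_self]
    simp
    ring
  rw [coeff_Q_comp, h6, jacobiCoeff, coeffA, Nat.choose_self]
  have h7 : ((-1 : ℝ)) ^ n ≠ 0 := by simp
  positivity

/-- Comparison of coefficients in the three term recursion. -/
theorem r_eq (hα : -1 < α) (hβ : -1 < β) (hN : 0 < N) (i : ℕ) :
    r α β N i = 1 + 2 * (leadingRatio α β N (i + 1) - leadingRatio α β N i) := by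
  have h := congrArg (fun f : ℝ[X] => f.comp (1 - C 2 * X)) (X_mul_Q hα hβ hN i)
  simp only [mul_comp (C _), add_comp, C_comp] at h
  rw [mul_comp, X_comp, sub_mul, one_mul, mul_assoc] at h
  have htop := congrArg (fun f : ℝ[X] => f.coeff (i + 1)) h
  have hnext := congrArg (fun f : ℝ[X] => f.coeff i) h
  simp only [coeff_sub, coeff_add, coeff_C_mul, coeff_X_mul] at htop hnext
  rw [coeff_Q_comp_eq_zero (Nat.lt_succ_self i),
    coeff_Q_comp_eq_zero (n := i - 1) (by omega)] at htop
  have hqz : q α β N i * ((Q α β N (i - 1)).comp (1 - C 2 * X)).coeff i = 0 := by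
    rcases i with - | i
    · simp [q]
    · rw [coeff_Q_comp_eq_zero (by omega), mul_zero]
  have hX : (X * (Q α β N i).comp (1 - C 2 * X)).coeff i =
      leadingRatio α β N i * ((Q α β N i).comp (1 - C 2 * X)).coeff i := by
    rcases i with - | i
    · simp [leadingRatio]
    · rw [leadingRatio, coeff_X_mul, div_mul_cancel₀ _ (coeff_Q_comp_self_ne_zero hα hβ hN _)]
  rw [hqz, hX] at hnext
  have hi := coeff_Q_comp_self_ne_zero hα hβ hN i
  have hi1 := coeff_Q_comp_self_ne_zero hα hβ hN (i + 1)
  have hL : ((Q α β N (i + 1)).comp (1 - C 2 * X)).coeff i =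
      leadingRatio α β N (i + 1) * ((Q α β N (i + 1)).comp (1 - C 2 * X)).coeff (i + 1) := by
    rw [leadingRatio, div_mul_cancel₀ _ hi1]
  rw [hL] at hnext
  refine mul_right_cancel₀ hi ?_
  linear_combination -hnext + leadingRatio α β N (i + 1) * htop

theorem sum_r (hα : -1 < α) (hβ : -1 < β) (hN : 0 < N) (n : ℕ) :
    ∑ i ∈ Finset.range n, r α β N i = n + 2 * leadingRatio α β N n := by
  induction n with
  | zero => simp [leadingRatio]
  | succ n ih =>
    rw [Finset.sum_range_succ, ih, r_eq hα hβ hN]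
    push_cast
    ring

/-- The truncated traces of `H` are bounded above; they tend to `(β - α) / 2`. -/
theorem sum_r_le (hα : -1 < α) (hβ : -1 < β) (hN : 0 < N) (n : ℕ) :
    (∑ i ∈ Finset.range (n + 1), r α β N i) * (2 * (n + 1) + α + β) ≤
      (n + 1) * (β - α) + 2 * (α + 1) := by
  have hn : (0 : ℝ) ≤ n := n.cast_nonneg
  have ha : 0 < α + 1 := by linarith
  have hS : 0 < 2 * ((n : ℝ) + 1) + α + β := by linarith
  set u := jacobiCoeff α β (n + 1) (n + 1) with hu
  set G := coeffB α β N (n + 1) - N * ((n + 1 : ℕ) : ℝ) with hG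
  have hG0 : 0 < G := coeffB_sub_pos hα hβ hN (n + 1)
  have hGle : N * (n + 1) * (n + 1 + β) < (α + 1) * G := by
    have := le_coeffB_sub (N := N) hα hβ (n + 1)
    push_cast at this
    rw [hG]
    push_cast
    exact this
  have hB : coeffB α β N (n + 1) = G + N * (n + 1) := by rw [hG]; push_cast; ring
  have hu1 : jacobiCoeff α β (n + 1) (n + 1 + 1) = 0 := by
    rw [jacobiCoeff, Nat.choose_succ_self]
    simp
  have hlow : jacobiCoeff α β (n + 1) n * (2 * (n + 1) + α + β) =
      -((n + 1) * (n + 1 + α)) * u := by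
    rw [hu, jacobiCoeff, jacobiCoeff, Nat.choose_self, Nat.choose_succ_self_right, poch_succ,
      poch_succ]
    have h1 := poch_ne_zero ha n
    have h2 : α + 1 + n ≠ 0 := by positivity
    field_simp
    push_cast
    ring
  have hc := coeff_Q_comp_self_ne_zero hα hβ hN (n + 1)
  have hratio : leadingRatio α β N (n + 1) * (G * u) =
      N * (n + 1) * u + (G + N) * jacobiCoeff α β (n + 1) n := by
    have h : leadingRatio α β N (n + 1) * ((Q α β N (n + 1)).comp (1 - C 2 * X)).coeff (n + 1) =
        ((Q α β N (n + 1)).comp (1 - C 2 * X)).coeff n := by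
      rw [leadingRatio, div_mul_cancel₀ _ hc]
    rw [coeff_Q_comp] at hc
    rw [coeff_Q_comp, coeff_Q_comp, hu1, hB] at h
    have h5 := right_ne_zero_of_mul hc
    have h6 := left_ne_zero_of_mul (left_ne_zero_of_mul hc)
    refine mul_left_cancel₀ h6 (mul_right_cancel₀ h5 ?_)
    rw [← hu] at h
    push_cast at h ⊢
    linear_combination h
  have hu0 : u ≠ 0 := by
    intro h0
    rw [coeff_Q_comp, hu1, ← hu, h0] at hc
    simp at hc
  have hGu : leadingRatio α β N (n + 1) * (2 * (n + 1) + α + β) * G =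
      N * (n + 1) * (2 * (n + 1) + α + β) - (G + N) * ((n + 1) * (n + 1 + α)) := by
    refine mul_right_cancel₀ hu0 ?_
    linear_combination (2 * (n + 1) + α + β) * hratio + (G + N) * hlow
  rw [sum_r hα hβ hN]
  refine le_of_mul_le_mul_right ?_ hG0
  push_cast
  nlinarith [hGu, hGle]

/-- A lower bound for the diagonal of `H` bounds `lam` from below, and at `lam = 0` it constrains
the parameters of the weight. -/
theorem lam_pos_or (hα : -1 < α) (hβ : -1 < β) (hN : 0 < N) {lam : ℝ}
    (hr : ∀ i, -lam ≤ r α β N i) : 0 < lam ∨ lam = 0 ∧ α ≤ β := by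
  have hsum : ∀ n : ℕ, (n + 1) * -lam * (2 * (n + 1) + α + β) ≤
      (n + 1) * (β - α) + 2 * (α + 1) := by
    intro n
    have hn : (0 : ℝ) ≤ n := n.cast_nonneg
    refine le_trans (mul_le_mul_of_nonneg_right ?_ (by linarith)) (sum_r_le hα hβ hN n)
    have := Finset.card_nsmul_le_sum (Finset.range (n + 1)) (r α β N) (-lam) fun i _ => hr i
    simpa using this
  by_contra! hcon
  obtain ⟨h1, h2⟩ := hcon
  rcases h1.lt_or_eq with h1 | h1
  · obtain ⟨n, hn⟩ := exists_nat_gt ((|β - α| + 2 * (α + 1) - -lam * (α + β)) / -lam)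
    rw [div_lt_iff₀ (by linarith)] at hn
    have hn0 : (0 : ℝ) ≤ n := n.cast_nonneg
    have h3 := hsum n
    have h4 : (n + 1) * (-lam * (2 * (n + 1) + α + β)) ≤
        (n + 1) * (|β - α| + 2 * (α + 1)) := by
      have := le_abs_self (β - α)
      nlinarith
    have h5 := le_of_mul_le_mul_left h4 (by positivity)
    nlinarith
  · have hαβ := h2 h1
    obtain ⟨n, hn⟩ := exists_nat_gt (2 * (α + 1) / (α - β))
    rw [div_lt_iff₀ (by linarith)] at hn
    have h3 := hsum n
    rw [h1] at h3
    simp only [neg_zero, mul_zero, zero_mul] at h3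
    linarith

end

/-- A constant for the decay of the spectral integral, in all cases where there is one. -/
theorem exists_integral_abs_pow_le {α β : ℝ} (hα : -1 < α) (hβ : -1 < β) (lam : ℝ) :
    ∃ K : ℝ, 0 < lam ∨ lam = 0 ∧ α ≤ β → ∀ t : ℕ,
      ∫ x, |(x + lam) / (lam + 1)| ^ t ∂(jacobiMeasure α β) ≤ K / ((t : ℝ) + 1) ^ (1 + α) := by
  by_cases h : 0 < lam ∨ lam = 0 ∧ α ≤ β
  · rcases h with h | ⟨rfl, h⟩
    · obtain ⟨K, hK⟩ := exists_integral_abs_pow_le_of_pos hα hβ h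
      exact ⟨K, fun _ => hK⟩
    · obtain ⟨K, hK⟩ := exists_integral_abs_pow_le_of_le hα hβ h
      exact ⟨K, fun _ => by simpa using hK⟩
  · exact ⟨0, fun h' => absurd h' h⟩

end

end KoornwinderJacobi

theorem lemma3p1 (α β lam : ℝ) (hα : -1 < α) (hβ : -1 < β) :
    ∃ K : ℝ, ∀ N : ℝ, 0 < N →
      -- the numbers `p`, `r`, `q` are the coefficients of the three term recursion
      (∀ i : ℕ, Polynomial.X * KoornwinderJacobi.Q α β N i =
        Polynomial.C (KoornwinderJacobi.p α β N i) * KoornwinderJacobi.Q α β N (i + 1) +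
        Polynomial.C (KoornwinderJacobi.r α β N i) * KoornwinderJacobi.Q α β N i +
        Polynomial.C (KoornwinderJacobi.q α β N i) * KoornwinderJacobi.Q α β N (i - 1)) ∧
      ((∀ n : ℕ, 0 < KoornwinderJacobi.p α β N n) →
       (∀ n : ℕ, 1 ≤ n → 0 < KoornwinderJacobi.q α β N n) →
       -- `lam ≥ - inf r_i`
       (∀ i : ℕ, -lam ≤ KoornwinderJacobi.r α β N i) →
        Summable (KoornwinderJacobi.revMeasure α β N) ∧
        (∀ ν : ℕ → ℝ,
          KoornwinderJacobi.IsStationaryDistribution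
            (KoornwinderJacobi.transition α β N lam) ν ↔
          ν = KoornwinderJacobi.stationary α β N) ∧
        ∀ j t : ℕ,
          KoornwinderJacobi.tvDist (KoornwinderJacobi.stationary α β N)
              (KoornwinderJacobi.law α β N lam j t) ≤
            K * KoornwinderJacobi.supNorm (KoornwinderJacobi.Q α β N j) /
                ((t : ℝ) + 1) ^ (1 + α) *
              (∑ n ∈ Finset.range (t + j + 1), KoornwinderJacobi.revMeasure α β N n *
                KoornwinderJacobi.supNorm (KoornwinderJacobi.Q α β N n)) +
            1 / 2 * ∑' n : ℕ, KoornwinderJacobi.revMeasure α β N (n + (j + t + 1))) := by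
  obtain ⟨K, hK⟩ := KoornwinderJacobi.exists_integral_abs_pow_le hα hβ lam
  refine ⟨K, fun N hN => ⟨KoornwinderJacobi.X_mul_Q hα hβ hN, fun hp hq hr => ?_⟩⟩
  -- the only use of `r_i ≥ -lam`: it excludes the values of `lam` for which the decay is too slow
  have hlam := KoornwinderJacobi.lam_pos_or hα hβ hN hr
  have hlam0 : 0 ≤ lam := hlam.elim le_of_lt fun h => h.1.ge
  exact ⟨KoornwinderJacobi.summable_revMeasure hα hβ hN hq,
    KoornwinderJacobi.isStationaryDistribution_iff hα hβ hN hp hq hlam0,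
    fun j t => KoornwinderJacobi.tvDist_le hα hβ hN hq hlam0 j t (hK hlam t)⟩
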